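/- Let $M$ be a smooth manifold of dimension $m$, $V\to M$ a smooth real vector bundle of rank $n$, $g$ a smooth Riemannian metric on $V$, $\nabla$ a smooth connection on $V$ which respects $g$, and $\varphi$ a smooth $1$-form on $M$ with values in $V$ (the data $(M,V,g,\nabla,\varphi)$ are called a Riemannian $0$-puzzle). Assume that the puzzle is integrable, i.e. $d^\nabla\varphi=0$, that is $$\nabla_X(\varphi(Y))-\nabla_Y(\varphi(X))-\varphi([X,Y])=0\quad\text{for all vector fields }X,Y,$$ and that $\varphi_x:T_xM\to V_x$ is injective for every $x\in M$. Let $NM\subset V$ be the normal bundle, i.e. the subbundle of rank $n-m$ whose fibre $N_xM$ is the $g$-orthogonal complement of $\varphi_x(T_xM)$ in $V_x$; for $O\subset M$ let $N_OM$ be the part of the total space of $NM$ above $O$, and let $\iota$ be the zero section. Then every point of $M$ has an open neighbourhood $O$ such that there is a smooth Riemannian metric $G$ on the manifold $N_OM$, with Levi-Civita connection $\nabla^G$ on $T(N_OM)$, for which 1. $\iota:(O,\varphi^*g)\to(N_OM,G)$ is an isometric embedding, where $(\varphi^*g)(\xi,\eta)=g(\varphi(\xi),\varphi(\eta))$; 2.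 the restriction to $O$ of $(M,V,g,\nabla,\varphi)$ is the pull-back by $\iota$ of the puzzle $(N_OM,T(N_OM),G,\nabla^G,\mathrm{Id})$. This means that there is a smooth vector bundle isomorphism $\Phi:V|_O\to\iota^*T(N_OM)$ over $O$ which carries $g$ to $\iota^*G$, $\nabla$ to the pulled-back connection $\iota^*\nabla^G$, and $\varphi$ to $\iota^*\mathrm{Id}=d\iota$, i.e. $\Phi\circ\varphi=d\iota$. -/

import Mathlib

open Bundle Set
open scoped Manifold ContDiff Topology

noncomputable section

namespace Puzzle

section Defs

variable {E : Type*} [NormedAddCommGroup E] [NormedSpace ℝ E]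
  {H : Type*} [TopologicalSpace H] (I : ModelWithCorners ℝ E H)
  {M : Type*} [TopologicalSpace M] [ChartedSpace H M] [IsManifold I ∞ M]
  (F : Type*) [NormedAddCommGroup F] [NormedSpace ℝ F]
  (V : M → Type*) [TopologicalSpace (TotalSpace F V)]
  [∀ x, AddCommGroup (V x)] [∀ x, Module ℝ (V x)] [∀ x, TopologicalSpace (V x)]
  [∀ x, IsTopologicalAddGroup (V x)] [∀ x, ContinuousSMul ℝ (V x)]
  [FiberBundle F V] [VectorBundle ℝ F V]

/-- A Riemannian 0-puzzle `(U, V|_U, g, ∇, φ)` over the open subset `U` of the manifold `M`: the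
vector bundle `V` carries over `U` a smooth Riemannian metric `g`, a smooth connection `∇`
respecting `g`, and a smooth `V`-valued 1-form `φ`. The values of the fields at points outside `U`
are irrelevant. As in `CovariantDerivative`, `nabla σ x ξ` is `(∇_ξ σ)(x)`. -/
structure RiemannianPuzzle (U : Set M) where
  /-- the metric on the fibres -/
  g : Π x : M, V x →L[ℝ] V x →L[ℝ] ℝ
  /-- the connection -/
  nabla : (Π x : M, V x) → (Π x : M, TangentSpace I x →L[ℝ] V x)
  /-- the 1-form with values in `V` -/
  φ : Π x : M, TangentSpace I x →L[ℝ] V x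
  isOpen : IsOpen U
  g_symm : ∀ x ∈ U, ∀ v w : V x, g x v w = g x w v
  g_pos : ∀ x ∈ U, ∀ v : V x, v ≠ 0 → 0 < g x v v
  g_smooth : ContMDiffOn I (I.prod 𝓘(ℝ, F →L[ℝ] F →L[ℝ] ℝ)) ∞
    (fun x ↦ TotalSpace.mk' (F →L[ℝ] F →L[ℝ] ℝ) x (g x)) U
  nabla_isCovariantDerivative : IsCovariantDerivativeOn F nabla U
  /-- `∇` is smooth: it sends sections smooth at a point to sections smooth at this point -/
  nabla_smooth : ∀ x ∈ U, ∀ σ : Π x : M, V x,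
    ContMDiffAt I (I.prod 𝓘(ℝ, F)) ∞ (fun y ↦ TotalSpace.mk' F y (σ y)) x →
    ContMDiffAt I (I.prod 𝓘(ℝ, E →L[ℝ] F)) ∞ (fun y ↦ TotalSpace.mk' (E →L[ℝ] F) y (nabla σ y)) x
  /-- `∇` respects `g`: `ξ (g(σ, τ)) = g(∇_ξ σ, τ) + g(σ, ∇_ξ τ)` -/
  nabla_metric : ∀ x ∈ U, ∀ σ τ : Π x : M, V x,
    MDifferentiableAt I (I.prod 𝓘(ℝ, F)) (fun y ↦ TotalSpace.mk' F y (σ y)) x →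
    MDifferentiableAt I (I.prod 𝓘(ℝ, F)) (fun y ↦ TotalSpace.mk' F y (τ y)) x →
    ∀ ξ : TangentSpace I x,
      mvfderiv I (fun y ↦ g y (σ y) (τ y)) x ξ =
        g x (nabla σ x ξ) (τ x) + g x (σ x) (nabla τ x ξ)
  φ_smooth : ContMDiffOn I (I.prod 𝓘(ℝ, E →L[ℝ] F)) ∞
    (fun x ↦ TotalSpace.mk' (E →L[ℝ] F) x (φ x)) U

variable {I F V}

namespace RiemannianPuzzle

variable {U : Set M}

/-- The covariant exterior differential of the solder form, evaluated on two vector fields: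
`d^∇φ(X, Y) = ∇_X (φ Y) - ∇_Y (φ X) - φ [X, Y]`. -/
def dNablaφ (P : RiemannianPuzzle I F V U) (X Y : Π x : M, TangentSpace I x) (x : M) : V x :=
  P.nabla (fun y ↦ P.φ y (Y y)) x (X x) - P.nabla (fun y ↦ P.φ y (X y)) x (Y x)
    - P.φ x (VectorField.mlieBracket I X Y x)

/-- The puzzle is integrable: `d^∇φ = 0` on `U`. -/
def IsIntegrable (P : RiemannianPuzzle I F V U) : Prop :=
  ∀ x ∈ U, ∀ X Y : Π x : M, TangentSpace I x,
    MDifferentiableAt I (I.prod 𝓘(ℝ, E)) (fun y ↦ TotalSpace.mk' E y (X y)) x →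
    MDifferentiableAt I (I.prod 𝓘(ℝ, E)) (fun y ↦ TotalSpace.mk' E y (Y y)) x →
    P.dNablaφ X Y x = 0

/-- The solder form is injective everywhere. -/
def IsInjective (P : RiemannianPuzzle I F V U) : Prop :=
  ∀ x ∈ U, Function.Injective (P.φ x)

/-- For a puzzle on the tangent bundle: the connection is torsion free. As it respects the metric
of the puzzle, it is then the Levi-Civita connection of this metric. -/
def IsLeviCivita (P : RiemannianPuzzle I E (TangentSpace I : M → Type _) U) : Prop :=
  ∀ x ∈ U, ∀ X Y : Π x : M, TangentSpace I x,
    MDifferentiableAt I (I.prod 𝓘(ℝ, E)) (fun y ↦ TotalSpace.mk' E y (X y)) x →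
    MDifferentiableAt I (I.prod 𝓘(ℝ, E)) (fun y ↦ TotalSpace.mk' E y (Y y)) x →
    P.nabla Y x (X x) - P.nabla X x (Y x) = VectorField.mlieBracket I X Y x

/-- For a puzzle on the tangent bundle: the solder form is the identity. -/
def HasIdentityForm (P : RiemannianPuzzle I E (TangentSpace I : M → Type _) U) : Prop :=
  ∀ x ∈ U, P.φ x = ContinuousLinearMap.id ℝ (TangentSpace I x)

section Pullback

variable {E' : Type*} [NormedAddCommGroup E'] [NormedSpace ℝ E']
  {H' : Type*} [TopologicalSpace H'] {I' : ModelWithCorners ℝ E' H'}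
  {M' : Type*} [TopologicalSpace M'] [ChartedSpace H' M'] [IsManifold I' ∞ M']
  {F' : Type*} [NormedAddCommGroup F'] [NormedSpace ℝ F']
  {V' : M' → Type*} [TopologicalSpace (TotalSpace F' V')]
  [∀ x, AddCommGroup (V' x)] [∀ x, Module ℝ (V' x)] [∀ x, TopologicalSpace (V' x)]
  [∀ x, IsTopologicalAddGroup (V' x)] [∀ x, ContinuousSMul ℝ (V' x)]
  [FiberBundle F' V'] [VectorBundle ℝ F' V']
  {U' : Set M'}

/-- The restriction of the puzzle `P` to the open set `O ⊆ U` is the pull-back of the puzzle `Q` by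
the smooth map `u : O → U'`, through the vector bundle isomorphism `Φ : V|_O → u^*V'` over `O`,
where `Φ x` is the isomorphism of the fibres at `x`. -/
structure IsPullbackVia (P : RiemannianPuzzle I F V U) (Q : RiemannianPuzzle I' F' V' U')
    (O : Set M) (u : M → M') (Φ : Π x : M, V x →L[ℝ] V' (u x)) : Prop where
  isOpen : IsOpen O
  subset : O ⊆ U
  mapsTo : MapsTo u O U'
  u_smooth : ContMDiffOn I I' ∞ u O
  Φ_bijective : ∀ x ∈ O, Function.Bijective (Φ x)
  Φ_smooth : ContMDiffOn (I.prod 𝓘(ℝ, F)) (I'.prod 𝓘(ℝ, F')) ∞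
    (fun p : TotalSpace F V ↦ TotalSpace.mk' F' (u p.1) (Φ p.1 p.2)) (TotalSpace.proj ⁻¹' O)
  /-- the metric of `P` is the pull-back of that of `Q` -/
  g_eq : ∀ x ∈ O, ∀ v w : V x, P.g x v w = Q.g (u x) (Φ x v) (Φ x w)
  /-- the 1-form of `P` is the pull-back `ξ ↦ φ'(du ξ)` of that of `Q` -/
  φ_eq : ∀ x ∈ O, ∀ ξ : TangentSpace I x, Φ x (P.φ x ξ) = Q.φ (u x) (mfderiv I I' u x ξ)
  /-- the connection of `P` is the pull-back of that of `Q`, i.e. the connection characterized by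
  `(u^*∇')_ξ (τ ∘ u) = ∇'_{du ξ} τ` for the sections `τ` of `V'` -/
  nabla_eq : ∀ x ∈ O, ∀ (σ : Π x : M, V x) (τ : Π x : M', V' x),
    MDifferentiableAt I (I.prod 𝓘(ℝ, F)) (fun y ↦ TotalSpace.mk' F y (σ y)) x →
    MDifferentiableAt I' (I'.prod 𝓘(ℝ, F')) (fun y ↦ TotalSpace.mk' F' y (τ y)) (u x) →
    (∀ᶠ y in 𝓝 x, Φ y (σ y) = τ (u y)) →
    ∀ ξ : TangentSpace I x, Φ x (P.nabla σ x ξ) = Q.nabla τ (u x) (mfderiv I I' u x ξ)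

/-- The restriction of the puzzle `P` to `O` is (isomorphic to) the pull-back of `Q` by `u`. -/
def IsPullback (P : RiemannianPuzzle I F V U) (Q : RiemannianPuzzle I' F' V' U')
    (O : Set M) (u : M → M') : Prop :=
  ∃ Φ : Π x : M, V x →L[ℝ] V' (u x), IsPullbackVia P Q O u Φ

end Pullback

end RiemannianPuzzle

end Defs

section NormalBundle

set_option linter.unusedSectionVars false

variable {E : Type*} [NormedAddCommGroup E] [NormedSpace ℝ E] [FiniteDimensional ℝ E]
  {H : Type*} [TopologicalSpace H] {I : ModelWithCorners ℝ E H}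
  {M : Type*} [TopologicalSpace M] [ChartedSpace H M] [IsManifold I ∞ M]
  {F : Type*} [NormedAddCommGroup F] [NormedSpace ℝ F] [FiniteDimensional ℝ F]
  {V : M → Type*} [TopologicalSpace (TotalSpace F V)]
  [∀ x, AddCommGroup (V x)] [∀ x, Module ℝ (V x)] [∀ x, TopologicalSpace (V x)]
  [∀ x, IsTopologicalAddGroup (V x)] [∀ x, ContinuousSMul ℝ (V x)]
  [FiberBundle F V] [VectorBundle ℝ F V] [ContMDiffVectorBundle ∞ F V I]

namespace RiemannianPuzzle

/-- The normal space `N_x`: the subspace of `V_x` orthogonal to `H_x = φ_x(T_x M)`. -/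
def normalSpace (P : RiemannianPuzzle I F V univ) (x : M) : Submodule ℝ (V x) where
  carrier := {v | ∀ ξ : TangentSpace I x, P.g x v (P.φ x ξ) = 0}
  add_mem' := by intro a b ha hb ξ; simp [ha ξ, hb ξ]
  zero_mem' := by intro ξ; simp
  smul_mem' := by intro c a ha ξ; simp [ha ξ]

/-- The fibre at `x` of the normal bundle `NM`. -/
def NormalFiber (P : RiemannianPuzzle I F V univ) (_h : P.IsInjective) (x : M) : Type _ :=
  P.normalSpace x

variable (E F) in
/-- The model fibre of the normal bundle, of dimension `rank V - dim M`. -/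
abbrev NormalModel : Type :=
  EuclideanSpace ℝ (Fin (Module.finrank ℝ F - Module.finrank ℝ E))

variable (P : RiemannianPuzzle I F V univ) (h : P.IsInjective)

instance (x : M) : AddCommGroup (NormalFiber P h x) :=
  inferInstanceAs (AddCommGroup (P.normalSpace x))

instance (x : M) : Module ℝ (NormalFiber P h x) :=
  inferInstanceAs (Module ℝ (P.normalSpace x))

instance (x : M) : TopologicalSpace (NormalFiber P h x) :=
  inferInstanceAs (TopologicalSpace (P.normalSpace x))

instance (x : M) : IsTopologicalAddGroup (NormalFiber P h x) :=
  inferInstanceAs (IsTopologicalAddGroup (P.normalSpace x))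

instance (x : M) : ContinuousSMul ℝ (NormalFiber P h x) :=
  inferInstanceAs (ContinuousSMul ℝ (P.normalSpace x))

/-- The inclusion `N_x ⊆ V_x`. -/
def normalIncl (x : M) : NormalFiber P h x →L[ℝ] V x :=
  (P.normalSpace x).subtypeL

/-- The orthogonality relation read in the trivializations of `V` and `TM` around `x₀`:
`(f, ξ) ↦ g_x(f_V, φ_x(ξ_T))`, where `f_V` and `ξ_T` have coordinates `f` and `ξ`. -/
def pairing (x₀ x : M) : F →L[ℝ] E →L[ℝ] ℝ :=
  (ContinuousLinearMap.precomp ℝ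
    (P.φ x ∘L (trivializationAt E (TangentSpace I : M → Type _) x₀).symmL ℝ x)) ∘L
    (P.g x ∘L (trivializationAt F V x₀).symmL ℝ x)

theorem pairing_apply (x₀ x : M) (f : F) (ξ : E) :
    P.pairing x₀ x f ξ = P.g x ((trivializationAt F V x₀).symmL ℝ x f)
      (P.φ x ((trivializationAt E (TangentSpace I : M → Type _) x₀).symmL ℝ x ξ)) := rfl

/-- The common domain of the trivializations of `V` and `TM` around `x₀`. -/
def dom (_P : RiemannianPuzzle I F V univ) (x₀ : M) : Set M :=
  (trivializationAt F V x₀).baseSet ∩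
    (trivializationAt E (TangentSpace I : M → Type _) x₀).baseSet

theorem isOpen_dom (x₀ : M) : IsOpen (P.dom x₀) :=
  (trivializationAt F V x₀).open_baseSet.inter
    (trivializationAt E (TangentSpace I : M → Type _) x₀).open_baseSet

theorem contMDiffOn_of_apply {G : Type*} [NormedAddCommGroup G] [NormedSpace ℝ G]
    {F₀ : Type*} [NormedAddCommGroup F₀] [NormedSpace ℝ F₀] [FiniteDimensional ℝ F₀]
    {A : M → F₀ →L[ℝ] G} {s : Set M}
    (hA : ∀ f, ContMDiffOn I 𝓘(ℝ, G) ∞ (fun x ↦ A x f) s) :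
    ContMDiffOn I 𝓘(ℝ, F₀ →L[ℝ] G) ∞ A s := by
  classical
  let b := Module.finBasis ℝ F₀
  have key : A = fun x ↦ ∑ i, ContinuousLinearMap.smulRightL ℝ F₀ G
      (LinearMap.toContinuousLinearMap (b.coord i)) (A x (b i)) := by
    funext x
    ext v
    conv_lhs => rw [← b.sum_repr v, map_sum]
    simp
  rw [key]
  refine contMDiffOn_finsetSum fun i _ ↦ ?_
  exact (ContinuousLinearMap.smulRightL ℝ F₀ G
      (LinearMap.toContinuousLinearMap (b.coord i))).contMDiff.comp_contMDiffOn (hA (b i))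

theorem contMDiffOn_symmL_apply {F₀ : Type*} [NormedAddCommGroup F₀] [NormedSpace ℝ F₀]
    {V₀ : M → Type*} [TopologicalSpace (TotalSpace F₀ V₀)]
    [∀ x, AddCommGroup (V₀ x)] [∀ x, Module ℝ (V₀ x)] [∀ x, TopologicalSpace (V₀ x)]
    [FiberBundle F₀ V₀] [VectorBundle ℝ F₀ V₀] [ContMDiffVectorBundle ∞ F₀ V₀ I]
    (e : Trivialization F₀ (TotalSpace.proj : TotalSpace F₀ V₀ → M)) [MemTrivializationAtlas e]
    (f : F₀) :
    ContMDiffOn I (I.prod 𝓘(ℝ, F₀)) ∞ (fun x ↦ TotalSpace.mk' F₀ x (e.symmL ℝ x f)) e.baseSet := by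
  rw [e.contMDiffOn_section_baseSet_iff]
  refine (contMDiffOn_const (c := f)).congr fun x hx ↦ ?_
  rw [e.symmL_apply hx, e.apply_mk_symm hx]

theorem contMDiffOn_pairing (x₀ : M) :
    ContMDiffOn I 𝓘(ℝ, F →L[ℝ] E →L[ℝ] ℝ) ∞ (P.pairing x₀) (P.dom x₀) := by
  refine contMDiffOn_of_apply fun f ↦ contMDiffOn_of_apply fun ξ ↦ ?_
  have h1 := (contMDiffOn_symmL_apply (I := I) (trivializationAt F V x₀) f).mono
    (inter_subset_left : P.dom x₀ ⊆ _)
  have h2 := (contMDiffOn_symmL_apply (I := I)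
    (trivializationAt E (TangentSpace I : M → Type _) x₀) ξ).mono
    (inter_subset_right : P.dom x₀ ⊆ _)
  have h3 := (P.φ_smooth.mono (subset_univ (P.dom x₀))).clm_bundle_apply h2
  have h4 : ContMDiffOn I (I.prod 𝓘(ℝ)) ∞
      (fun x ↦ TotalSpace.mk' ℝ (E := Bundle.Trivial M ℝ) x (P.pairing x₀ x f ξ)) (P.dom x₀) :=
    ContMDiffOn.clm_bundle_apply₂ (F₁ := F) (F₂ := F) (F₃ := ℝ) (E₁ := V) (E₂ := V)
      (E₃ := Bundle.Trivial M ℝ) (b := fun x ↦ x) (P.g_smooth.mono (subset_univ (P.dom x₀))) h1 h3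
  intro x hx
  have := h4 x hx
  rw [contMDiffWithinAt_totalSpace] at this
  exact this.2

theorem mem_dom (x₀ : M) : x₀ ∈ P.dom x₀ :=
  ⟨mem_baseSet_trivializationAt F V x₀, mem_baseSet_trivializationAt E _ x₀⟩

theorem mem_normalSpace_iff {x₀ x : M} (hx : x ∈ P.dom x₀) (f : F) :
    (trivializationAt F V x₀).symmL ℝ x f ∈ P.normalSpace x ↔ P.pairing x₀ x f = 0 := by
  constructor
  · intro hf
    ext ξ
    exact hf _
  · intro hf ξ
    have h1 := DFunLike.congr_fun hf ((trivializationAt E (TangentSpace I : M → Type _)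
      x₀).continuousLinearMapAt ℝ x ξ)
    rw [pairing_apply, Trivialization.symmL_continuousLinearMapAt _ hx.2] at h1
    exact h1

theorem pairing_surjective (h : P.IsInjective) (x₀ : M) :
    Function.Surjective (P.pairing x₀ x₀) := by
  set e := trivializationAt F V x₀
  set t := trivializationAt E (TangentSpace I : M → Type _) x₀
  have he := (P.mem_dom x₀).1
  have ht := (P.mem_dom x₀).2
  let A : E →ₗ[ℝ] F :=
    (e.continuousLinearMapAt ℝ x₀ ∘L P.φ x₀ ∘L t.symmL ℝ x₀ : E →L[ℝ] F).toLinearMap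
  let B : E →ₗ[ℝ] (E →L[ℝ] ℝ) := (P.pairing x₀ x₀).toLinearMap ∘ₗ A
  have hB : Function.Injective B := by
    rw [← LinearMap.ker_eq_bot, LinearMap.ker_eq_bot']
    intro ξ hξ
    have h1 : P.g x₀ (P.φ x₀ (t.symmL ℝ x₀ ξ)) (P.φ x₀ (t.symmL ℝ x₀ ξ)) = 0 := by
      have h5 : P.pairing x₀ x₀ (e.continuousLinearMapAt ℝ x₀ (P.φ x₀ (t.symmL ℝ x₀ ξ))) ξ = 0 :=
        DFunLike.congr_fun hξ ξ
      rw [pairing_apply, e.symmL_continuousLinearMapAt he] at h5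
      exact h5
    have h2 : P.φ x₀ (t.symmL ℝ x₀ ξ) = 0 := by
      by_contra hne
      exact (P.g_pos x₀ trivial _ hne).ne' h1
    have h3 : t.symmL ℝ x₀ ξ = 0 := h x₀ trivial (by rw [h2, map_zero])
    have h4 := t.continuousLinearMapAt_symmL (R := ℝ) ht ξ
    rw [h3, map_zero] at h4
    exact h4.symm
  have hfin : Module.finrank ℝ E = Module.finrank ℝ (E →L[ℝ] ℝ) := by
    rw [← LinearEquiv.finrank_eq (LinearMap.toContinuousLinearMap (𝕜 := ℝ) (E := E) (F' := ℝ))]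
    exact (Subspace.dual_finrank_eq (K := ℝ) (V := E)).symm
  have hs := (LinearMap.injective_iff_surjective_of_finrank_eq_finrank hfin).1 hB
  intro y
  obtain ⟨ξ, hξ⟩ := hs y
  exact ⟨A ξ, hξ⟩

theorem exists_proj (h : P.IsInjective) (x₀ : M) : ∃ p : F →L[ℝ] NormalModel E F,
    (p.prod (P.pairing x₀ x₀)).IsInvertible := by
  have hsurj := P.pairing_surjective h x₀
  have hr : (P.pairing x₀ x₀).toLinearMap.range = ⊤ := LinearMap.range_eq_top.2 hsurj
  have hfin : Module.finrank ℝ (E →L[ℝ] ℝ) = Module.finrank ℝ E := by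
    rw [← LinearEquiv.finrank_eq (LinearMap.toContinuousLinearMap (𝕜 := ℝ) (E := E) (F' := ℝ))]
    exact Subspace.dual_finrank_eq (K := ℝ) (V := E)
  have hker : Module.finrank ℝ (P.pairing x₀ x₀).toLinearMap.ker =
      Module.finrank ℝ (NormalModel E F) := by
    have := LinearMap.finrank_range_add_finrank_ker (P.pairing x₀ x₀).toLinearMap
    rw [hr, finrank_top, hfin] at this
    rw [finrank_euclideanSpace_fin]
    omega
  obtain ⟨q, hq⟩ := Submodule.exists_isCompl (P.pairing x₀ x₀).toLinearMap.ker
  let L := LinearEquiv.ofFinrankEq _ _ hker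
  let pr := (P.pairing x₀ x₀).toLinearMap.ker.projectionOnto q hq
  let p : F →L[ℝ] NormalModel E F := LinearMap.toContinuousLinearMap (L.toLinearMap ∘ₗ pr)
  refine ⟨p, ?_⟩
  have hp : ∀ f, p f = L (pr f) := fun f ↦ rfl
  have hinj : Function.Injective (p.prod (P.pairing x₀ x₀)).toLinearMap := by
    rw [← LinearMap.ker_eq_bot, LinearMap.ker_eq_bot']
    intro f hf
    have h1 : p f = 0 := congrArg Prod.fst hf
    have h2 : P.pairing x₀ x₀ f = 0 := congrArg Prod.snd hf
    rw [hp, LinearEquiv.map_eq_zero_iff] at h1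
    have h3 : pr f = ⟨f, h2⟩ :=
      Submodule.projectionOnto_apply_left hq ⟨f, h2⟩
    rw [h1] at h3
    exact (congrArg Subtype.val h3).symm
  have hfin2 : Module.finrank ℝ F = Module.finrank ℝ (NormalModel E F × (E →L[ℝ] ℝ)) := by
    have := LinearMap.finrank_range_add_finrank_ker (P.pairing x₀ x₀).toLinearMap
    rw [hr, finrank_top, hfin] at this
    rw [Module.finrank_prod, finrank_euclideanSpace_fin, hfin]
    omega
  let Lq := (LinearEquiv.ofInjectiveOfFinrankEq _ hinj hfin2).toContinuousLinearEquiv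
  exact ⟨Lq, by ext <;> rfl⟩

/-- A linear projection completing the orthogonality relation to a system of coordinates of the
fibre of `V` at `x₀`. -/
def proj₀ (x₀ : M) : F →L[ℝ] NormalModel E F := Classical.choose (P.exists_proj h x₀)

/-- The coordinates of the fibres of `V` adapted to the normal bundle, around `x₀`. -/
def adapted (x₀ x : M) : F →L[ℝ] NormalModel E F × (E →L[ℝ] ℝ) :=
  (P.proj₀ h x₀).prod (P.pairing x₀ x)

/-- The domain of the trivialization of the normal bundle around `x₀`. -/
def normalBaseSet (x₀ : M) : Set M := {x ∈ P.dom x₀ | (P.adapted h x₀ x).IsInvertible}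

theorem contMDiffOn_adapted (x₀ : M) :
    ContMDiffOn I 𝓘(ℝ, F →L[ℝ] NormalModel E F × (E →L[ℝ] ℝ)) ∞ (P.adapted h x₀) (P.dom x₀) := by
  refine contMDiffOn_of_apply fun f ↦ ?_
  exact contMDiffOn_const.prodMk_space ((P.contMDiffOn_pairing x₀).clm_apply contMDiffOn_const)

theorem isOpen_normalBaseSet (x₀ : M) : IsOpen (P.normalBaseSet h x₀) :=
  (P.contMDiffOn_adapted h x₀).continuousOn.isOpen_inter_preimage (P.isOpen_dom x₀)
    ContinuousLinearEquiv.isOpen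

theorem mem_normalBaseSet (x₀ : M) : x₀ ∈ P.normalBaseSet h x₀ :=
  ⟨P.mem_dom x₀, Classical.choose_spec (P.exists_proj h x₀)⟩

theorem adapted_bijective {x₀ x : M} (hx : x ∈ P.normalBaseSet h x₀) :
    Function.Bijective (P.adapted h x₀ x) := by
  obtain ⟨L, hL⟩ := hx.2
  rw [← hL]
  exact L.bijective

/-- The vector of `V_x` normal to the image of `φ_x` with given adapted coordinates. -/
def normalSymm (x₀ x : M) : NormalModel E F →L[ℝ] V x :=
  (trivializationAt F V x₀).symmL ℝ x ∘L (P.adapted h x₀ x).inverse ∘L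
    ContinuousLinearMap.inl ℝ (NormalModel E F) (E →L[ℝ] ℝ)

theorem adapted_inverse {x₀ x : M} (hx : x ∈ P.normalBaseSet h x₀)
    (y : NormalModel E F × (E →L[ℝ] ℝ)) :
    P.adapted h x₀ x ((P.adapted h x₀ x).inverse y) = y := by
  obtain ⟨L, hL⟩ := hx.2
  rw [← hL, ContinuousLinearMap.inverse_equiv]
  exact L.apply_symm_apply y

theorem normalSymm_mem {x₀ x : M} (hx : x ∈ P.normalBaseSet h x₀) (k : NormalModel E F) :
    P.normalSymm h x₀ x k ∈ P.normalSpace x :=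
  (P.mem_normalSpace_iff hx.1 _).2 (congrArg Prod.snd (P.adapted_inverse h hx (k, 0)))

/-- A vector of `V_x` lying in the normal space, as an element of the fibre of `NM`. -/
def mkNormal {x : M} {v : V x} (hv : v ∈ P.normalSpace x) : NormalFiber P h x :=
  (⟨v, hv⟩ : P.normalSpace x)

theorem normalIncl_injective (x : M) : Function.Injective (P.normalIncl h x) :=
  Subtype.val_injective

theorem normalIncl_mem {x : M} (v : NormalFiber P h x) : P.normalIncl h x v ∈ P.normalSpace x :=
  Subtype.property (p := (· ∈ P.normalSpace x)) v

open Classical in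
/-- The inverse of the trivialization of the normal bundle around `x₀`, on the fibre at `x`. -/
def normalInv (x₀ x : M) (k : NormalModel E F) : NormalFiber P h x :=
  if hx : x ∈ P.normalBaseSet h x₀ then
    mkNormal P h (P.normalSymm_mem h hx k) else 0

theorem normalIncl_normalInv {x₀ x : M} (hx : x ∈ P.normalBaseSet h x₀) (k : NormalModel E F) :
    P.normalIncl h x (P.normalInv h x₀ x k) = P.normalSymm h x₀ x k := by
  rw [normalInv, dif_pos hx]
  rfl

/-- The trivialization `(x, v) ↦ (x, p(v))` of the normal bundle around `x₀`, where `p` is the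
projection `proj₀` applied to the coordinates of `v ∈ N_x ⊆ V_x` around `x₀`. -/
def normalPretrivialization (x₀ : M) :
    Pretrivialization (NormalModel E F)
      (TotalSpace.proj : TotalSpace (NormalModel E F) (NormalFiber P h) → M) where
  toFun q := (q.1, P.proj₀ h x₀
    ((trivializationAt F V x₀).continuousLinearMapAt ℝ q.1 (P.normalIncl h q.1 q.2)))
  invFun y := ⟨y.1, P.normalInv h x₀ y.1 y.2⟩
  source := TotalSpace.proj ⁻¹' P.normalBaseSet h x₀
  target := P.normalBaseSet h x₀ ×ˢ univ
  map_source' := fun q hq ↦ ⟨hq, trivial⟩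
  map_target' := fun y hy ↦ hy.1
  left_inv' := by
    rintro ⟨x, v⟩ (hx : x ∈ P.normalBaseSet h x₀)
    have hv : P.pairing x₀ x ((trivializationAt F V x₀).continuousLinearMapAt ℝ x
        (P.normalIncl h x v)) = 0 := by
      rw [← P.mem_normalSpace_iff hx.1, Trivialization.symmL_continuousLinearMapAt _ hx.1.1]
      exact P.normalIncl_mem h v
    refine congrArg (TotalSpace.mk x) (P.normalIncl_injective h x ?_)
    rw [P.normalIncl_normalInv h hx]
    have hf : (P.adapted h x₀ x).inverse (P.proj₀ h x₀
        ((trivializationAt F V x₀).continuousLinearMapAt ℝ x (P.normalIncl h x v)), 0) =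
        (trivializationAt F V x₀).continuousLinearMapAt ℝ x (P.normalIncl h x v) := by
      apply (P.adapted_bijective h hx).1
      rw [P.adapted_inverse h hx]
      exact Prod.ext rfl hv.symm
    change (trivializationAt F V x₀).symmL ℝ x ((P.adapted h x₀ x).inverse (P.proj₀ h x₀
        ((trivializationAt F V x₀).continuousLinearMapAt ℝ x (P.normalIncl h x v)), 0)) = _
    rw [hf, Trivialization.symmL_continuousLinearMapAt _ hx.1.1]
  right_inv' := by
    rintro ⟨x, k⟩ ⟨hx : x ∈ P.normalBaseSet h x₀, -⟩
    refine Prod.ext rfl ?_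
    change P.proj₀ h x₀ ((trivializationAt F V x₀).continuousLinearMapAt ℝ x
      (P.normalIncl h x (P.normalInv h x₀ x k))) = k
    rw [P.normalIncl_normalInv h hx]
    change P.proj₀ h x₀ ((trivializationAt F V x₀).continuousLinearMapAt ℝ x
      ((trivializationAt F V x₀).symmL ℝ x ((P.adapted h x₀ x).inverse (k, 0)))) = k
    rw [Trivialization.continuousLinearMapAt_symmL _ hx.1.1]
    exact congrArg Prod.fst (P.adapted_inverse h hx (k, 0))
  open_target := (P.isOpen_normalBaseSet h x₀).prod isOpen_univ
  baseSet := P.normalBaseSet h x₀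
  open_baseSet := P.isOpen_normalBaseSet h x₀
  source_eq := rfl
  target_eq := rfl
  proj_toFun := fun _ _ ↦ rfl

theorem normalPretrivialization_symm {x₀ x : M} (hx : x ∈ P.normalBaseSet h x₀)
    (k : NormalModel E F) :
    P.normalIncl h x ((P.normalPretrivialization h x₀).symm x k) = P.normalSymm h x₀ x k := by
  have h1 : (P.normalPretrivialization h x₀).symm x k = P.normalInv h x₀ x k := by
    rw [Pretrivialization.symm_apply _ hx]
    rfl
  rw [h1, P.normalIncl_normalInv h hx]

theorem exists_normalCoordChange (x₀ x₁ : M) :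
    ∃ f : M → NormalModel E F →L[ℝ] NormalModel E F,
      ContMDiffOn I 𝓘(ℝ, NormalModel E F →L[ℝ] NormalModel E F) ∞ f
        (P.normalBaseSet h x₀ ∩ P.normalBaseSet h x₁) ∧
      ∀ b ∈ P.normalBaseSet h x₀ ∩ P.normalBaseSet h x₁, ∀ v : NormalModel E F,
        f b v = (P.normalPretrivialization h x₁
          ⟨b, (P.normalPretrivialization h x₀).symm b v⟩).2 := by
  refine ⟨fun b ↦ P.proj₀ h x₁ ∘L
    ((trivializationAt F V x₀).coordChangeL ℝ (trivializationAt F V x₁) b : F →L[ℝ] F) ∘L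
    (P.adapted h x₀ b).inverse ∘L ContinuousLinearMap.inl ℝ (NormalModel E F) (E →L[ℝ] ℝ), ?_, ?_⟩
  · refine contMDiffOn_const.clm_comp (ContMDiffOn.clm_comp ?_ (ContMDiffOn.clm_comp ?_
      contMDiffOn_const))
    · exact (contMDiffOn_coordChangeL (trivializationAt F V x₀) (trivializationAt F V x₁)).mono
        fun b hb ↦ ⟨hb.1.1.1, hb.2.1.1⟩
    · intro b hb
      have h1 := ((P.contMDiffOn_adapted h x₀) b hb.1.1).mono
        (show P.normalBaseSet h x₀ ∩ P.normalBaseSet h x₁ ⊆ P.dom x₀ from fun b hb ↦ hb.1.1)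
      exact (hb.1.2.contDiffAt_map_inverse (n := ∞)).contMDiffAt.comp_contMDiffWithinAt b h1
  · intro b hb v
    change _ = P.proj₀ h x₁ ((trivializationAt F V x₁).continuousLinearMapAt ℝ b
      (P.normalIncl h b ((P.normalPretrivialization h x₀).symm b v)))
    rw [P.normalPretrivialization_symm h hb.1]
    change P.proj₀ h x₁ ((trivializationAt F V x₀).coordChangeL ℝ (trivializationAt F V x₁) b
      ((P.adapted h x₀ b).inverse (v, 0))) = P.proj₀ h x₁
      ((trivializationAt F V x₁).continuousLinearMapAt ℝ b ((trivializationAt F V x₀).symmL ℝ b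
        ((P.adapted h x₀ b).inverse (v, 0))))
    rw [Trivialization.coordChangeL_apply _ _ ⟨hb.1.1.1, hb.2.1.1⟩]
    congr 1
    rw [Trivialization.continuousLinearMapAt_apply, Trivialization.coe_linearMapAt_of_mem _ hb.2.1.1,
      Trivialization.symmL_apply _ hb.1.1.1]

/-- The normal bundle as a vector bundle: its atlas consists of the trivializations above. -/
def normalPrebundle : VectorPrebundle ℝ (NormalModel E F) (NormalFiber P h) where
  pretrivializationAtlas := range (P.normalPretrivialization h)
  pretrivialization_linear' := by
    rintro _ ⟨x₀, rfl⟩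
    constructor
    intro x _
    exact ((P.proj₀ h x₀) ∘L ((trivializationAt F V x₀).continuousLinearMapAt ℝ x) ∘L
      (P.normalIncl h x)).toLinearMap.isLinear
  pretrivializationAt := P.normalPretrivialization h
  mem_base_pretrivializationAt := P.mem_normalBaseSet h
  pretrivialization_mem_atlas x := mem_range_self x
  exists_coordChange := by
    rintro _ ⟨x₀, rfl⟩ _ ⟨x₁, rfl⟩
    obtain ⟨f, hf, hf'⟩ := P.exists_normalCoordChange h x₀ x₁
    exact ⟨f, hf.continuousOn, hf'⟩
  totalSpaceMk_isInducing x₀ := by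
    have hx := P.mem_normalBaseSet h x₀
    let L : NormalFiber P h x₀ →L[ℝ] NormalModel E F := (P.proj₀ h x₀) ∘L
      ((trivializationAt F V x₀).continuousLinearMapAt ℝ x₀) ∘L (P.normalIncl h x₀)
    have hL : Topology.IsInducing L := by
      have hinv : ∀ v, P.normalSymm h x₀ x₀ (L v) = P.normalIncl h x₀ v := by
        intro v
        have := (P.normalPretrivialization h x₀).left_inv' (x := ⟨x₀, v⟩) hx
        have h2 : P.normalInv h x₀ x₀ (L v) = v := TotalSpace.mk_injective x₀ this
        rw [← P.normalIncl_normalInv h hx, h2]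
      have hi : Topology.IsInducing (P.normalIncl h x₀) := Topology.IsInducing.subtypeVal
      refine Topology.IsInducing.of_comp L.continuous (P.normalSymm h x₀ x₀).continuous ?_
      convert hi
      exact funext hinv
    have : (P.normalPretrivialization h x₀ ∘ TotalSpace.mk x₀) = Prod.mk x₀ ∘ L := rfl
    rw [this]
    exact (Topology.isInducing_const_prod.2 Topology.IsInducing.id).comp hL

instance : TopologicalSpace (TotalSpace (NormalModel E F) (NormalFiber P h)) :=
  (P.normalPrebundle h).totalSpaceTopology

instance : FiberBundle (NormalModel E F) (NormalFiber P h) :=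
  (P.normalPrebundle h).toFiberBundle

instance : VectorBundle ℝ (NormalModel E F) (NormalFiber P h) :=
  (P.normalPrebundle h).toVectorBundle

instance : (P.normalPrebundle h).IsContMDiff I ∞ where
  exists_contMDiffCoordChange := by
    rintro _ ⟨x₀, rfl⟩ _ ⟨x₁, rfl⟩
    exact P.exists_normalCoordChange h x₀ x₁

instance : ContMDiffVectorBundle ∞ (NormalModel E F) (NormalFiber P h) I :=
  (P.normalPrebundle h).contMDiffVectorBundle I

/-- The total space `NM` of the normal bundle, a manifold of dimension `rank V`. -/
abbrev NormalBundle : Type _ := TotalSpace (NormalModel E F) (NormalFiber P h)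

/-- The embedding `ι` of `M` in `NM` as the zero section. -/
abbrev zeroSec : M → NormalBundle P h := zeroSection (NormalModel E F) (NormalFiber P h)

/-- `N_O M`, the part of the total space of the normal bundle that lies above `O`. -/
def above (O : Set M) : Set (NormalBundle P h) := TotalSpace.proj ⁻¹' O

/-- The zero section is an isometric embedding of `(O, φ^*g)` in `(N_O M, G)`, for a metric `G` on
`N_O M`: it is a smooth embedding, and `G(dι ξ, dι η) = g(φ ξ, φ η)` over `O`. -/
def ZeroSecIsIsometricEmbedding (O : Set M)
    (G : Π p : NormalBundle P h, TangentSpace (I.prod 𝓘(ℝ, NormalModel E F)) p →L[ℝ]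
      TangentSpace (I.prod 𝓘(ℝ, NormalModel E F)) p →L[ℝ] ℝ) : Prop :=
  Manifold.IsSmoothEmbedding I (I.prod 𝓘(ℝ, NormalModel E F)) ∞ (P.zeroSec h) ∧
    ∀ x ∈ O, ∀ ξ η : TangentSpace I x,
      G (P.zeroSec h x) (mfderiv I (I.prod 𝓘(ℝ, NormalModel E F)) (P.zeroSec h) x ξ)
        (mfderiv I (I.prod 𝓘(ℝ, NormalModel E F)) (P.zeroSec h) x η) =
      P.g x (P.φ x ξ) (P.φ x η)

end RiemannianPuzzle
end NormalBundle
end Puzzle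

end

/-! Around `x₀`, the chart of `M` and the normal trivialization give a frame of `V` modelled on `W =
E × NormalModel E F`: it sends `(e, k)` to `φ(∂_e)` plus the normal vector with coordinate `k`. In
this frame the puzzle becomes a field `G₀` of inner products on `W` and a connection form `ω`, both
depending on the base coordinate `u ∈ E`. The total space above the domain of the frame is covered
by one chart, with coordinates `(u, y)`, and the bundle map `Φ` sends the frame to the coordinate
frame along `y = 0`. The task is thus to find a metric `G` on this chart equal to `G₀` at `y = 0`,
whose Christoffel symbols at `y = 0`, in the horizontal directions, are `ω`.

Integrability, tested on coordinate vector fields, says exactly that `ω_v(w, 0) = ω_w(v, 0)`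
(`normalForm_symm`). Hence `ω`, defined for horizontal directions only, extends to a symmetric
bilinear `Γ₀` on `W` (`normalChristoffel`), the vertical-vertical block being free and set to zero.
Define `G(u, y)(b, c) = G₀(b + Γ₀(y)b, c + Γ₀(y)c) + ‖y‖² G₀(b, c)`. At `y = 0` its derivative in
any direction `a` is `G₀(Γ₀(a)b, c) + G₀(b, Γ₀(a)c)`: for horizontal `a` because `∇` respects `g`,
for vertical `a` by construction (`fderiv_extendMetric`). By the Koszul formula a symmetric
compatible connection is unique, so `Γ₀` is the Levi-Civita connection of `G` along the zero section
(`eq_christoffel`). The term `‖y‖² G₀` does not affect first derivatives there and makes `G`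
positive definite on whole fibres.

It remains to transport this to the manifold: coefficients in a chart give a puzzle (`chartPuzzle`),
which is Levi-Civita when the symbols are symmetric, and matching coefficients give a pull-back
(`isPullbackVia_chartPuzzle`). -/

noncomputable section

namespace Puzzle

/-! ### Linear algebra of metrics and Christoffel symbols at one point. -/

section Model

set_option maxSynthPendingDepth 3

variable {W : Type*} [NormedAddCommGroup W] [NormedSpace ℝ W]

/-- The Koszul formula: a symmetric connection compatible with a metric is determined by the
derivative `D` of the metric. -/
theorem koszul_formula {G : W →L[ℝ] W →L[ℝ] ℝ} {D : W →L[ℝ] W →L[ℝ] W →L[ℝ] ℝ}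
    {Γ : W →L[ℝ] W →L[ℝ] W} (hG : ∀ b c, G b c = G c b) (hΓ : ∀ a b, Γ a b = Γ b a)
    (hD : ∀ a b c, D a b c = G (Γ a b) c + G b (Γ a c)) (a b c : W) :
    G (Γ a b) c = 2⁻¹ * (D a b c + D b a c - D c a b) := by
  rw [hD, hD, hD, hΓ b a, hΓ c a, hΓ c b, hG b (Γ a c), hG a (Γ b c)]
  ring

theorem injective_of_pos {G : W →L[ℝ] W →L[ℝ] ℝ} (hpos : ∀ b, b ≠ 0 → 0 < G b b) :
    Function.Injective G := by
  refine (injective_iff_map_eq_zero G).2 fun b hb ↦ ?_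
  by_contra hne
  exact (hpos b hne).ne' (by simp [hb])

theorem isInvertible_of_pos [FiniteDimensional ℝ W] {G : W →L[ℝ] W →L[ℝ] ℝ}
    (hpos : ∀ b, b ≠ 0 → 0 < G b b) : G.IsInvertible := by
  have hfin : Module.finrank ℝ W = Module.finrank ℝ (W →L[ℝ] ℝ) := by
    rw [← LinearEquiv.finrank_eq (LinearMap.toContinuousLinearMap (𝕜 := ℝ) (E := W) (F' := ℝ))]
    exact (Subspace.dual_finrank_eq (K := ℝ) (V := W)).symm
  let L := (LinearEquiv.ofInjectiveOfFinrankEq G.toLinearMap (injective_of_pos hpos)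
    hfin).toContinuousLinearEquiv
  exact ⟨L, rfl⟩

/-- The Christoffel symbols of the metric `G` with derivative `D`. -/
def christoffel (G : W →L[ℝ] W →L[ℝ] ℝ) (D : W →L[ℝ] W →L[ℝ] W →L[ℝ] ℝ) :
    W →L[ℝ] W →L[ℝ] W :=
  (ContinuousLinearMap.compL ℝ W (W →L[ℝ] ℝ) W G.inverse) ∘L
    -- At `a b c` the three summands are `D a b c`, `D b a c` and `D c a b`; `G.inverse` then raises
    -- the index `c`, which is meaningful only for invertible `G`.
    ((2⁻¹ : ℝ) • (D + D.flip -
      ((ContinuousLinearMap.flipₗᵢ ℝ W W ℝ).toContinuousLinearEquiv :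
        (W →L[ℝ] W →L[ℝ] ℝ) →L[ℝ] W →L[ℝ] W →L[ℝ] ℝ) ∘L D.flip))

theorem christoffel_apply {G : W →L[ℝ] W →L[ℝ] ℝ} {D : W →L[ℝ] W →L[ℝ] W →L[ℝ] ℝ}
    (hG : G.IsInvertible) (a b c : W) :
    G (christoffel G D a b) c = 2⁻¹ * (D a b c + D b a c - D c a b) := by
  have h1 : ∀ y, G (G.inverse y) = y := by
    obtain ⟨L, rfl⟩ := hG
    intro y
    rw [ContinuousLinearMap.inverse_equiv]
    exact L.apply_symm_apply y
  simp [christoffel, h1]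

variable {G : W → W →L[ℝ] W →L[ℝ] ℝ} {D : Set W}

theorem contDiffOn_christoffel [FiniteDimensional ℝ W] (hD : IsOpen D) (hG : ContDiffOn ℝ ∞ G D)
    (hpos : ∀ p ∈ D, ∀ b, b ≠ 0 → 0 < G p b b) :
    ContDiffOn ℝ ∞ (fun p ↦ christoffel (G p) (fderiv ℝ G p)) D := by
  have h1 : ContDiffOn ℝ ∞ (fderiv ℝ G) D := hG.fderiv_of_isOpen hD (by simp)
  have h2 : ContDiffOn ℝ ∞ (fun p ↦ (G p).inverse) D := fun p hp ↦
    ((isInvertible_of_pos (hpos p hp)).contDiffAt_map_inverse (n := ∞)).comp_contDiffWithinAt p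
      (hG p hp)
  have h3 : ContDiffOn ℝ ∞ (fun p ↦ (fderiv ℝ G p).flip) D :=
    (ContinuousLinearMap.flipₗᵢ ℝ W W (W →L[ℝ] ℝ)).contDiff.comp_contDiffOn h1
  refine ContDiffOn.clm_comp ?_ (ContDiffOn.const_smul _ ((h1.add h3).sub
    (contDiffOn_const.clm_comp h3)))
  exact (ContinuousLinearMap.compL ℝ W (W →L[ℝ] ℝ) W).contDiff.comp_contDiffOn h2

/-- Exchanging `a` and `b` permutes the first two Koszul terms and fixes the third, because `D c` is
symmetric. -/
theorem christoffel_symm {G : W →L[ℝ] W →L[ℝ] ℝ} {D : W →L[ℝ] W →L[ℝ] W →L[ℝ] ℝ}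
    (hG : G.IsInvertible) (hinj : Function.Injective G) (hD : ∀ a b c, D a b c = D a c b)
    (a b : W) : christoffel G D a b = christoffel G D b a := by
  apply hinj
  ext c
  rw [christoffel_apply hG, christoffel_apply hG, hD c a b]
  ring

theorem christoffel_compat {G : W →L[ℝ] W →L[ℝ] ℝ} {D : W →L[ℝ] W →L[ℝ] W →L[ℝ] ℝ}
    (hG : G.IsInvertible) (hs : ∀ b c, G b c = G c b) (hD : ∀ a b c, D a b c = D a c b)
    (a b c : W) : D a b c = G (christoffel G D a b) c + G b (christoffel G D a c) := by
  rw [hs b, christoffel_apply hG, christoffel_apply hG, hD a c b, hD b a c, hD c a b]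
  ring

/-- Uniqueness of the Levi-Civita connection, at a single point: it identifies the prescribed `Γ₀`
with the Christoffel symbols of the extended metric along the zero section, knowing only the first
derivative of that metric there. -/
theorem eq_christoffel {G : W →L[ℝ] W →L[ℝ] ℝ} {D : W →L[ℝ] W →L[ℝ] W →L[ℝ] ℝ}
    (hG : G.IsInvertible) (hinj : Function.Injective G) (hs : ∀ b c, G b c = G c b)
    {Γ : W →L[ℝ] W →L[ℝ] W} (hΓ : ∀ a b, Γ a b = Γ b a)
    (hD : ∀ a b c, D a b c = G (Γ a b) c + G b (Γ a c)) : christoffel G D = Γ := by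
  ext a b
  apply hinj
  ext c
  rw [christoffel_apply hG, koszul_formula hs hΓ hD]

theorem differentiableAt_apply₂ {X : Type*} [NormedAddCommGroup X] [NormedSpace ℝ X]
    {B : X → W →L[ℝ] W →L[ℝ] ℝ} {p : X} (hd : DifferentiableAt ℝ B p) (b c : W) :
    DifferentiableAt ℝ (fun q ↦ B q b c) p :=
  (hd.clm_apply (differentiableAt_const b)).clm_apply (differentiableAt_const c)

theorem fderiv_apply₂ {X : Type*} [NormedAddCommGroup X] [NormedSpace ℝ X]
    {B : X → W →L[ℝ] W →L[ℝ] ℝ} {p : X} (hd : DifferentiableAt ℝ B p) (a : X) (b c : W) :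
    fderiv ℝ B p a b c = fderiv ℝ (fun q ↦ B q b c) p a := by
  have := (hd.hasFDerivAt.clm_apply (hasFDerivAt_const b p)).clm_apply (hasFDerivAt_const c p)
  rw [this.fderiv]
  simp

end Model

/-! ### Extension of a metric off `E × 0` with prescribed first derivative. -/

section Extension

set_option maxSynthPendingDepth 3

variable {E : Type*} [NormedAddCommGroup E] [NormedSpace ℝ E]
  {N : Type*} [NormedAddCommGroup N] [InnerProductSpace ℝ N]

/-- A metric on a neighbourhood of `E × 0` in `E × N` with given value `G₀` and given Christoffel
symbols `Γ₀` along `E × 0`; it is positive definite on the whole of `E × N`. -/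
def extendMetric (G₀ : E → (E × N) →L[ℝ] (E × N) →L[ℝ] ℝ)
    (Γ₀ : E → (E × N) →L[ℝ] (E × N) →L[ℝ] (E × N)) (p : E × N) :
    (E × N) →L[ℝ] (E × N) →L[ℝ] ℝ :=
  -- The operator `1 + Γ₀(0, y)` produces the wanted vertical derivative at `y = 0`, but may be
  -- singular for large `y`. The last term repairs positivity where `y ≠ 0` and vanishes to second
  -- order at `y = 0`.
  (G₀ p.1).bilinearComp (ContinuousLinearMap.id ℝ (E × N) + Γ₀ p.1 (0, p.2))
    (ContinuousLinearMap.id ℝ (E × N) + Γ₀ p.1 (0, p.2)) + (‖p.2‖ ^ 2) • G₀ p.1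

variable {G₀ : E → (E × N) →L[ℝ] (E × N) →L[ℝ] ℝ}
  {Γ₀ : E → (E × N) →L[ℝ] (E × N) →L[ℝ] (E × N)} {Ω : Set E}

theorem extendMetric_apply (p b c : E × N) :
    extendMetric G₀ Γ₀ p b c = G₀ p.1 (b + Γ₀ p.1 (0, p.2) b) (c + Γ₀ p.1 (0, p.2) c) +
      ‖p.2‖ ^ 2 * G₀ p.1 b c := rfl

attribute [irreducible] extendMetric

theorem extendMetric_zero (u : E) : extendMetric G₀ Γ₀ (u, 0) = G₀ u := by
  refine ContinuousLinearMap.ext fun b ↦ ContinuousLinearMap.ext fun c ↦ ?_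
  have h : ((0, 0) : E × N) = 0 := rfl
  simp [extendMetric_apply, h]

/-- For `y ≠ 0` the first term is only nonnegative and the second is positive; no smallness of `y`
is needed, so the metric lives on entire fibres. -/
theorem extendMetric_pos {u : E} (hpos : ∀ b, b ≠ 0 → 0 < G₀ u b b) (y : N) (b : E × N)
    (hb : b ≠ 0) : 0 < extendMetric G₀ Γ₀ (u, y) b b := by
  by_cases hy : y = 0
  · rw [hy, extendMetric_zero]
    exact hpos b hb
  · rw [extendMetric_apply]
    have h1 : 0 ≤ G₀ u (b + Γ₀ u (0, y) b) (b + Γ₀ u (0, y) b) := by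
      by_cases h : b + Γ₀ u (0, y) b = 0
      · simp [h]
      · exact (hpos _ h).le
    have h2 : 0 < ‖y‖ ^ 2 * G₀ u b b := mul_pos (by positivity) (hpos b hb)
    exact add_pos_of_nonneg_of_pos h1 h2

variable [FiniteDimensional ℝ E] [FiniteDimensional ℝ N]

theorem contDiffOn_extendMetric (hG : ContDiffOn ℝ ∞ G₀ Ω) (hΓ : ContDiffOn ℝ ∞ Γ₀ Ω) :
    ContDiffOn ℝ ∞ (extendMetric G₀ Γ₀) (Ω ×ˢ univ) := by
  have h1 : ContDiffOn ℝ ∞ (fun p : E × N ↦ G₀ p.1) (Ω ×ˢ univ) :=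
    hG.comp contDiffOn_fst fun p hp ↦ hp.1
  have h2 : ContDiffOn ℝ ∞ (fun p : E × N ↦ Γ₀ p.1) (Ω ×ˢ univ) :=
    hΓ.comp contDiffOn_fst fun p hp ↦ hp.1
  have h3 : ContDiffOn ℝ ∞ (fun p : E × N ↦ ((0, p.2) : E × N)) (Ω ×ˢ univ) :=
    contDiffOn_const.prodMk contDiffOn_snd
  -- The inner product structure on `N` serves here: it makes the squared norm smooth, including at
  -- `0`.
  have h4 : ContDiffOn ℝ ∞ (fun p : E × N ↦ ‖p.2‖ ^ 2) (Ω ×ˢ univ) :=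
    contDiffOn_snd.norm_sq ℝ
  refine contDiffOn_clm_apply.2 fun b ↦ contDiffOn_clm_apply.2 fun c ↦ ?_
  simp only [extendMetric_apply]
  have h5 : ∀ b, ContDiffOn ℝ ∞ (fun p : E × N ↦ b + Γ₀ p.1 (0, p.2) b) (Ω ×ˢ univ) := fun b ↦
    contDiffOn_const.add ((h2.clm_apply h3).clm_apply contDiffOn_const)
  exact ((h1.clm_apply (h5 b)).clm_apply (h5 c)).add
    (h4.mul ((h1.clm_apply contDiffOn_const).clm_apply contDiffOn_const))

/-- The direction splits as `(e, 0) + (0, k)`. On `E × 0` the metric is `G₀`, so the horizontal part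
is the hypothesis of compatibility; the vertical part is read off along the line `t ↦ (u, t k)`. -/
theorem fderiv_extendMetric (hΩ : IsOpen Ω) (hG : ContDiffOn ℝ ∞ G₀ Ω) (hΓ : ContDiffOn ℝ ∞ Γ₀ Ω)
    {u : E} (hu : u ∈ Ω)
    (hcompat : ∀ e b c, fderiv ℝ G₀ u e b c =
      G₀ u (Γ₀ u (e, 0) b) c + G₀ u b (Γ₀ u (e, 0) c)) (a b c : E × N) :
    fderiv ℝ (extendMetric G₀ Γ₀) (u, 0) a b c =
      G₀ u (Γ₀ u a b) c + G₀ u b (Γ₀ u a c) := by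
  have hd : DifferentiableAt ℝ (extendMetric G₀ Γ₀) (u, (0 : N)) :=
    ((contDiffOn_extendMetric hG hΓ).contDiffAt ((hΩ.prod isOpen_univ).mem_nhds
      ⟨hu, trivial⟩)).differentiableAt (by simp)
  obtain ⟨e, k⟩ := a
  have he : fderiv ℝ (extendMetric G₀ Γ₀) (u, 0) (e, 0) = fderiv ℝ G₀ u e := by
    have h1 : HasFDerivAt (fun v : E ↦ (v, (0 : N))) (ContinuousLinearMap.inl ℝ E N) u :=
      hasFDerivAt_prodMk_left u 0
    have h2 := hd.hasFDerivAt.comp u h1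
    have h3 : extendMetric G₀ Γ₀ ∘ (fun v : E ↦ (v, (0 : N))) = G₀ :=
      funext fun v ↦ extendMetric_zero v
    rw [h3] at h2
    rw [h2.fderiv]
    rfl
  have hk : fderiv ℝ (extendMetric G₀ Γ₀) (u, 0) (0, k) b c =
      G₀ u (Γ₀ u (0, k) b) c + G₀ u b (Γ₀ u (0, k) c) := by
    have h1 : HasDerivAt (fun t : ℝ ↦ ((u, t • k) : E × N)) (0, k) 0 := by
      have := ((hasDerivAt_id (0 : ℝ)).smul_const k)
      rw [one_smul] at this
      exact (hasDerivAt_const (0 : ℝ) u).prodMk this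
    have hd' := (differentiableAt_apply₂ hd b c).hasFDerivAt
    rw [show ((u, 0) : E × N) = (fun t : ℝ ↦ ((u, t • k) : E × N)) 0 by simp] at hd'
    have h2 := hd'.comp_hasDerivAt (0 : ℝ) h1
    -- On this line the metric is exactly a quadratic polynomial in `t`, and the derivative at `0`
    -- is its linear coefficient.
    have h3 : ∀ t : ℝ, ((fun q ↦ extendMetric G₀ Γ₀ q b c) ∘ fun t : ℝ ↦ ((u, t • k) : E × N)) t =
        G₀ u b c + t * (G₀ u (Γ₀ u (0, k) b) c + G₀ u b (Γ₀ u (0, k) c)) +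
        t ^ 2 * (G₀ u (Γ₀ u (0, k) b) (Γ₀ u (0, k) c) + ‖k‖ ^ 2 * G₀ u b c) := by
      intro t
      have h4 : ((0, t • k) : E × N) = t • (0, k) := by simp
      rw [Function.comp_apply, extendMetric_apply]
      simp only [h4, map_smul, map_add, add_apply,
        smul_apply, smul_eq_mul, norm_smul, mul_pow, Real.norm_eq_abs, sq_abs]
      ring
    have h5 : HasDerivAt (fun t : ℝ ↦ G₀ u b c + t * (G₀ u (Γ₀ u (0, k) b) c +
        G₀ u b (Γ₀ u (0, k) c)) +
        t ^ 2 * (G₀ u (Γ₀ u (0, k) b) (Γ₀ u (0, k) c) + ‖k‖ ^ 2 * G₀ u b c))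
        (G₀ u (Γ₀ u (0, k) b) c + G₀ u b (Γ₀ u (0, k) c)) 0 := by
      have := ((hasDerivAt_const (0 : ℝ) (G₀ u b c)).add ((hasDerivAt_id (0 : ℝ)).mul_const
        (G₀ u (Γ₀ u (0, k) b) c + G₀ u b (Γ₀ u (0, k) c)))).add
        ((hasDerivAt_pow 2 (0 : ℝ)).mul_const
        (G₀ u (Γ₀ u (0, k) b) (Γ₀ u (0, k) c) + ‖k‖ ^ 2 * G₀ u b c))
      simpa using! this
    rw [funext h3] at h2
    rw [← h2.unique h5, fderiv_apply₂ hd]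
    simp only [zero_smul]
  have hek : ((e, k) : E × N) = (e, 0) + (0, k) := by simp
  rw [hek, map_add, add_apply, add_apply, he, hk,
    hcompat, map_add]
  simp only [map_add, add_apply]
  ring

/-- A metric `G₀` on the bundle `(E × N) × Ω → Ω`, together with a compatible connection which
is the restriction of a symmetric `Γ₀`, extends to a Riemannian metric on `Ω × N` and its
Christoffel symbols. -/
theorem exists_metric_extension (hΩ : IsOpen Ω) (hG : ContDiffOn ℝ ∞ G₀ Ω)
    (hΓ : ContDiffOn ℝ ∞ Γ₀ Ω) (hs : ∀ u ∈ Ω, ∀ b c, G₀ u b c = G₀ u c b)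
    (hpos : ∀ u ∈ Ω, ∀ b, b ≠ 0 → 0 < G₀ u b b) (hΓs : ∀ u ∈ Ω, ∀ a b, Γ₀ u a b = Γ₀ u b a)
    (hcompat : ∀ u ∈ Ω, ∀ e b c, fderiv ℝ G₀ u e b c =
      G₀ u (Γ₀ u (e, 0) b) c + G₀ u b (Γ₀ u (e, 0) c)) :
    ∃ (G : E × N → (E × N) →L[ℝ] (E × N) →L[ℝ] ℝ)
      (Γ : E × N → (E × N) →L[ℝ] (E × N) →L[ℝ] (E × N)),
      ContDiffOn ℝ ∞ G (Ω ×ˢ univ) ∧ ContDiffOn ℝ ∞ Γ (Ω ×ˢ univ) ∧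
      (∀ p ∈ Ω ×ˢ (univ : Set N), ∀ b c, G p b c = G p c b) ∧
      (∀ p ∈ Ω ×ˢ (univ : Set N), ∀ b, b ≠ 0 → 0 < G p b b) ∧
      (∀ p ∈ Ω ×ˢ (univ : Set N), ∀ a b, Γ p a b = Γ p b a) ∧
      (∀ p ∈ Ω ×ˢ (univ : Set N), ∀ a b c,
        fderiv ℝ G p a b c = G p (Γ p a b) c + G p b (Γ p a c)) ∧
      ∀ u ∈ Ω, G (u, 0) = G₀ u ∧ Γ (u, 0) = Γ₀ u := by
  set D : Set (E × N) := Ω ×ˢ univ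
  set G := extendMetric G₀ Γ₀ with hGdef
  have hD : IsOpen D := hΩ.prod isOpen_univ
  have hGs := contDiffOn_extendMetric hG hΓ
  have hsym : ∀ p ∈ D, ∀ b c, G p b c = G p c b := by
    intro p hp b c
    rw [hGdef, extendMetric_apply, extendMetric_apply, hs p.1 hp.1, hs p.1 hp.1 b]
  have hp' : ∀ p ∈ D, ∀ b, b ≠ 0 → 0 < G p b b := fun p hp ↦ extendMetric_pos (hpos p.1 hp.1) p.2
  have hDs : ∀ p ∈ D, ∀ a b c, fderiv ℝ G p a b c = fderiv ℝ G p a c b := by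
    intro p hp a b c
    have hd : DifferentiableAt ℝ G p := (hGs.contDiffAt (hD.mem_nhds hp)).differentiableAt (by simp)
    rw [fderiv_apply₂ hd, fderiv_apply₂ hd]
    refine DFunLike.congr_fun (Filter.EventuallyEq.fderiv_eq ?_) a
    filter_upwards [hD.mem_nhds hp] with q hq using hsym q hq b c
  refine ⟨G, fun p ↦ christoffel (G p) (fderiv ℝ G p), hGs, contDiffOn_christoffel hD hGs hp',
    hsym, hp', fun p hp ↦ christoffel_symm (isInvertible_of_pos (hp' p hp))
      (injective_of_pos (hp' p hp)) (hDs p hp),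
    fun p hp ↦ christoffel_compat (isInvertible_of_pos (hp' p hp)) (hsym p hp) (hDs p hp),
    fun u hu ↦ ⟨extendMetric_zero u, ?_⟩⟩
  change christoffel (extendMetric G₀ Γ₀ (u, 0)) (fderiv ℝ (extendMetric G₀ Γ₀) (u, 0)) = _
  rw [extendMetric_zero]
  -- `Γ₀` is symmetric and compatible with the first derivative of the extension, so uniqueness
  -- applies.
  refine eq_christoffel (isInvertible_of_pos (hpos u hu)) (injective_of_pos (hpos u hu)) (hs u hu)
    (hΓs u hu) fun a b c ↦ fderiv_extendMetric hΩ hG hΓ hu (hcompat u hu) a b c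

end Extension

/-! ### Derivatives, smooth sections and Lie brackets read in a chart. -/

section Chart

set_option linter.unusedSectionVars false
set_option maxSynthPendingDepth 3

variable {E : Type*} [NormedAddCommGroup E] [NormedSpace ℝ E]
  {H : Type*} [TopologicalSpace H] {I : ModelWithCorners ℝ E H} [I.Boundaryless]
  {M : Type*} [TopologicalSpace M] [ChartedSpace H M] [IsManifold I ∞ M]
  {G : Type*} [NormedAddCommGroup G] [NormedSpace ℝ G]

variable (E I M) in
/-- The trivialization of the tangent bundle given by the chart at `p₀`. -/
abbrev tangentTriv (p₀ : M) :
    Trivialization E (TotalSpace.proj : TotalSpace E (TangentSpace I : M → Type _) → M) :=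
  trivializationAt E (TangentSpace I : M → Type _) p₀

variable {p₀ p : M}

theorem mdifferentiableAt_chart_symm (hp : p ∈ (chartAt H p₀).source) :
    MDifferentiableAt 𝓘(ℝ, E) I (extChartAt I p₀).symm (extChartAt I p₀ p) := by
  have h1 : extChartAt I p₀ p ∈ (extChartAt I p₀).target :=
    (extChartAt I p₀).map_source (by rwa [extChartAt_source])
  have h2 := mdifferentiableWithinAt_extChartAt_symm (I := I) h1
  rwa [I.range_eq_univ, mdifferentiableWithinAt_univ] at h2

theorem differentiableAt_chart {f : M → G} (hp : p ∈ (chartAt H p₀).source)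
    (hf : MDifferentiableAt I 𝓘(ℝ, G) f p) :
    DifferentiableAt ℝ (f ∘ (extChartAt I p₀).symm) (extChartAt I p₀ p) := by
  have h0 : (extChartAt I p₀).symm (extChartAt I p₀ p) = p :=
    (extChartAt I p₀).left_inv (by rwa [extChartAt_source])
  rw [← h0] at hf
  exact (hf.comp _ (mdifferentiableAt_chart_symm hp)).differentiableAt

theorem contDiffAt_chart {f : M → G} (hp : p ∈ (chartAt H p₀).source)
    (hf : ContMDiffAt I 𝓘(ℝ, G) ∞ f p) :
    ContDiffAt ℝ ∞ (f ∘ (extChartAt I p₀).symm) (extChartAt I p₀ p) := by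
  have hs : p ∈ (extChartAt I p₀).source := by rwa [extChartAt_source]
  have h0 : (extChartAt I p₀).symm (extChartAt I p₀ p) = p := (extChartAt I p₀).left_inv hs
  rw [← h0] at hf
  have h1 : ContMDiffAt 𝓘(ℝ, E) I ∞ (extChartAt I p₀).symm (extChartAt I p₀ p) :=
    (contMDiffOn_extChartAt_symm p₀).contMDiffAt
      ((isOpen_extChartAt_target p₀).mem_nhds ((extChartAt I p₀).map_source hs))
  exact (hf.comp _ h1).contDiffAt

theorem contMDiffAt_comp_chart {f : E → G} (hp : p ∈ (chartAt H p₀).source)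
    (hf : ContDiffAt ℝ ∞ f (extChartAt I p₀ p)) :
    ContMDiffAt I 𝓘(ℝ, G) ∞ (f ∘ extChartAt I p₀) p :=
  hf.contMDiffAt.comp p (contMDiffAt_extChartAt' hp)

/-- The derivative of a function, read in a chart. -/
theorem mvfderiv_eq_chart {f : M → G} (hp : p ∈ (chartAt H p₀).source)
    (hf : MDifferentiableAt I 𝓘(ℝ, G) f p) (ξ : TangentSpace I p) :
    mvfderiv I f p ξ = fderiv ℝ (f ∘ (extChartAt I p₀).symm) (extChartAt I p₀ p)
      ((tangentTriv E I M p₀).continuousLinearMapAt ℝ p ξ) := by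
  have h1 : f =ᶠ[𝓝 p] (f ∘ (extChartAt I p₀).symm) ∘ extChartAt I p₀ := by
    filter_upwards [(chartAt H p₀).open_source.mem_nhds hp] with q hq
    rw [Function.comp_apply, Function.comp_apply,
      (extChartAt I p₀).left_inv (by rwa [extChartAt_source])]
  have h2 : MDifferentiableAt 𝓘(ℝ, E) 𝓘(ℝ, G) (f ∘ (extChartAt I p₀).symm) (extChartAt I p₀ p) :=
    (differentiableAt_chart hp hf).mdifferentiableAt
  change mfderiv I 𝓘(ℝ, G) f p ξ = _
  -- The fibre coordinate in `tangentTriv` is the derivative of the chart, so the formula is the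
  -- chain rule.
  rw [h1.mfderiv_eq, mfderiv_comp p h2 (mdifferentiableAt_extChartAt hp),
    TangentBundle.continuousLinearMapAt_trivializationAt hp, mfderiv_eq_fderiv]
  rfl

/-- Fibre coordinates are expressed by `continuousLinearMapAt`, which is linear on every fibre; it
agrees with the trivialization on the base set, which suffices because smoothness is local. -/
theorem contMDiffAt_section_iff_clmAt {F : Type*} [NormedAddCommGroup F] [NormedSpace ℝ F]
    {V : M → Type*} [TopologicalSpace (TotalSpace F V)]
    [∀ x, AddCommGroup (V x)] [∀ x, Module ℝ (V x)] [∀ x, TopologicalSpace (V x)]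
    [FiberBundle F V] [VectorBundle ℝ F V] [ContMDiffVectorBundle ∞ F V I]
    (e : Trivialization F (TotalSpace.proj : TotalSpace F V → M)) [MemTrivializationAtlas e]
    (hp : p ∈ e.baseSet) (σ : Π x : M, V x) :
    ContMDiffAt I (I.prod 𝓘(ℝ, F)) ∞ (fun y ↦ TotalSpace.mk' F y (σ y)) p ↔
      ContMDiffAt I 𝓘(ℝ, F) ∞ (fun y ↦ e.continuousLinearMapAt ℝ y (σ y)) p := by
  rw [e.contMDiffAt_section_iff hp]
  refine Filter.EventuallyEq.contMDiffAt_iff ?_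
  filter_upwards [e.open_baseSet.mem_nhds hp] with y hy
  rw [Trivialization.continuousLinearMapAt_apply, e.coe_linearMapAt_of_mem hy]

theorem mdifferentiableAt_section_iff_clmAt {F : Type*} [NormedAddCommGroup F] [NormedSpace ℝ F]
    {V : M → Type*} [TopologicalSpace (TotalSpace F V)]
    [∀ x, AddCommGroup (V x)] [∀ x, Module ℝ (V x)] [∀ x, TopologicalSpace (V x)]
    [FiberBundle F V] [VectorBundle ℝ F V] [ContMDiffVectorBundle ∞ F V I]
    (e : Trivialization F (TotalSpace.proj : TotalSpace F V → M)) [MemTrivializationAtlas e]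
    (hp : p ∈ e.baseSet) (σ : Π x : M, V x) :
    MDifferentiableAt I (I.prod 𝓘(ℝ, F)) (fun y ↦ TotalSpace.mk' F y (σ y)) p ↔
      MDifferentiableAt I 𝓘(ℝ, F) (fun y ↦ e.continuousLinearMapAt ℝ y (σ y)) p := by
  have : ContMDiffVectorBundle 1 F V I := ContMDiffVectorBundle.of_le (n := ∞) (by simp)
  rw [e.mdifferentiableAt_section_iff I σ hp]
  refine Filter.EventuallyEq.mdifferentiableAt_iff ?_
  filter_upwards [e.open_baseSet.mem_nhds hp] with y hy
  rw [Trivialization.continuousLinearMapAt_apply, e.coe_linearMapAt_of_mem hy]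

theorem contMDiffAt_of_apply {F₀ : Type*} [NormedAddCommGroup F₀] [NormedSpace ℝ F₀]
    [FiniteDimensional ℝ F₀] {A : M → F₀ →L[ℝ] G}
    (hA : ∀ f, ContMDiffAt I 𝓘(ℝ, G) ∞ (fun x ↦ A x f) p) :
    ContMDiffAt I 𝓘(ℝ, F₀ →L[ℝ] G) ∞ A p := by
  classical
  let b := Module.finBasis ℝ F₀
  have key : A = fun x ↦ ∑ i, ContinuousLinearMap.smulRightL ℝ F₀ G
      (LinearMap.toContinuousLinearMap (b.coord i)) (A x (b i)) := by
    funext x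
    ext v
    conv_lhs => rw [← b.sum_repr v, map_sum]
    simp
  rw [key]
  refine contMDiffAt_finsetSum fun i _ ↦ ?_
  exact (ContinuousLinearMap.smulRightL ℝ F₀ G
      (LinearMap.toContinuousLinearMap (b.coord i))).contMDiff.contMDiffAt.comp p (hA (b i))

/-- A section of a bundle of homomorphisms is smooth if its values on the constant sections of a
trivialization are smooth. -/
theorem contMDiffAt_hom_of_apply {F₁ : Type*} [NormedAddCommGroup F₁] [NormedSpace ℝ F₁]
    [FiniteDimensional ℝ F₁]
    {V₁ : M → Type*} [TopologicalSpace (TotalSpace F₁ V₁)]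
    [∀ x, AddCommGroup (V₁ x)] [∀ x, Module ℝ (V₁ x)] [∀ x, TopologicalSpace (V₁ x)]
    [∀ x, IsTopologicalAddGroup (V₁ x)] [∀ x, ContinuousSMul ℝ (V₁ x)]
    [FiberBundle F₁ V₁] [VectorBundle ℝ F₁ V₁] [ContMDiffVectorBundle ∞ F₁ V₁ I]
    {F₂ : Type*} [NormedAddCommGroup F₂] [NormedSpace ℝ F₂]
    {V₂ : M → Type*} [TopologicalSpace (TotalSpace F₂ V₂)]
    [∀ x, AddCommGroup (V₂ x)] [∀ x, Module ℝ (V₂ x)] [∀ x, TopologicalSpace (V₂ x)]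
    [∀ x, IsTopologicalAddGroup (V₂ x)] [∀ x, ContinuousSMul ℝ (V₂ x)]
    [FiberBundle F₂ V₂] [VectorBundle ℝ F₂ V₂] [ContMDiffVectorBundle ∞ F₂ V₂ I]
    (e : Trivialization F₁ (TotalSpace.proj : TotalSpace F₁ V₁ → M)) [MemTrivializationAtlas e]
    (hp : p ∈ e.baseSet) (A : Π x : M, V₁ x →L[ℝ] V₂ x)
    (h : ∀ f, ContMDiffAt I (I.prod 𝓘(ℝ, F₂)) ∞
      (fun y ↦ TotalSpace.mk' F₂ y (A y (e.symmL ℝ y f))) p) :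
    ContMDiffAt I (I.prod 𝓘(ℝ, F₁ →L[ℝ] F₂)) ∞
      (fun y ↦ TotalSpace.mk' (F₁ →L[ℝ] F₂) y (A y)) p := by
  have hp' := mem_baseSet_trivializationAt F₂ V₂ p
  rw [(e.continuousLinearMap (RingHom.id ℝ) (trivializationAt F₂ V₂ p)).contMDiffAt_section_iff
    (s := A) ⟨hp, hp'⟩]
  exact contMDiffAt_of_apply fun f ↦
    (contMDiffAt_section_iff_clmAt (trivializationAt F₂ V₂ p) hp' _).1 (h f)

/-- The Lie bracket of vector fields, read in a chart. -/
theorem mlieBracket_eq_chart [FiniteDimensional ℝ E] (hp : p ∈ (chartAt H p₀).source)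
    (X Y : Π x : M, TangentSpace I x)
    (hX : MDifferentiableAt I (I.prod 𝓘(ℝ, E)) (fun y ↦ TotalSpace.mk' E y (X y)) p)
    (hY : MDifferentiableAt I (I.prod 𝓘(ℝ, E)) (fun y ↦ TotalSpace.mk' E y (Y y)) p) :
    (tangentTriv E I M p₀).continuousLinearMapAt ℝ p (VectorField.mlieBracket I X Y p) =
      mvfderiv I (fun q ↦ (tangentTriv E I M p₀).continuousLinearMapAt ℝ q (Y q)) p (X p) -
      mvfderiv I (fun q ↦ (tangentTriv E I M p₀).continuousLinearMapAt ℝ q (X q)) p (Y p) := by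
  have : CompleteSpace E := FiniteDimensional.complete ℝ E
  have : IsManifold I (minSmoothness ℝ 2) M := by
    rw [minSmoothness_of_isRCLikeNormedField]
    infer_instance
  set T := tangentTriv E I M p₀ with hT
  set ψ := extChartAt I p₀ with hψ
  have hb : p ∈ T.baseSet := hp
  have hX' := (mdifferentiableAt_section_iff_clmAt T hb X).1 hX
  have hY' := (mdifferentiableAt_section_iff_clmAt T hb Y).1 hY
  set x : M → E := fun q ↦ T.continuousLinearMapAt ℝ q (X q) with hx
  set y : M → E := fun q ↦ T.continuousLinearMapAt ℝ q (Y q) with hy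
  -- The coordinates of `X` and `Y` become vector fields on `E` whose pull-backs by the chart are
  -- `X` and `Y` near `p`. Naturality of the bracket then reduces the claim to the bracket of a
  -- vector space.
  let fld : (M → E) → Π v : E, TangentSpace 𝓘(ℝ, E) v := fun f v ↦ f (ψ.symm v)
  have pull : ∀ Z : Π x : M, TangentSpace I x,
      VectorField.mpullback I 𝓘(ℝ, E) ψ (fld fun q ↦ T.continuousLinearMapAt ℝ q (Z q))
        =ᶠ[𝓝 p] Z := by
    intro Z
    filter_upwards [(chartAt H p₀).open_source.mem_nhds hp] with q hq
    have hq' : q ∈ (extChartAt I p₀).source := by rwa [extChartAt_source]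
    rw [VectorField.mpullback_apply]
    have h1 := TangentBundle.continuousLinearMapAt_trivializationAt (I := I) hq
    obtain ⟨L, hL⟩ := isInvertible_mfderiv_extChartAt (I := I) hq'
    rw [← hL, ContinuousLinearMap.inverse_equiv]
    have h2 : fld (fun q ↦ T.continuousLinearMapAt ℝ q (Z q)) (ψ q) = L (Z q) := by
      change T.continuousLinearMapAt ℝ (ψ.symm (ψ q)) (Z (ψ.symm (ψ q))) = _
      rw [(extChartAt I p₀).left_inv hq']
      exact (DFunLike.congr_fun h1 (Z q)).trans (DFunLike.congr_fun hL.symm (Z q))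
    rw [h2]
    exact L.symm_apply_apply _
  have hfld : ∀ f : M → E, MDifferentiableAt I 𝓘(ℝ, E) f p →
      MDifferentiableAt 𝓘(ℝ, E) (𝓘(ℝ, E).prod 𝓘(ℝ, E)) (fun v ↦ TotalSpace.mk' E v (fld f v))
        (ψ p) := by
    intro f hf
    rw [mdifferentiableAt_section]
    have h1 := (differentiableAt_chart hp hf).mdifferentiableAt
    convert! h1 using 1
    funext v
    simp only [trivializationAt_model_space_apply]
    rfl
  have key := VectorField.mpullback_mlieBracket (I := I) (I' := 𝓘(ℝ, E)) (n := ∞) (f := ψ)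
    (V := fld x) (W := fld y) (x₀ := p) (hfld x hX') (hfld y hY')
    (contMDiffAt_extChartAt' hp)
    (by rw [minSmoothness_of_isRCLikeNormedField]; exact ENat.LEInfty.out)
  rw [((pull X).mlieBracket_vectorField_eq (pull Y))] at key
  rw [← key, VectorField.mpullback_apply, ← VectorField.mlieBracketWithin_univ,
    VectorField.mlieBracketWithin_eq_lieBracketWithin, VectorField.lieBracketWithin_univ]
  rw [mvfderiv_eq_chart hp hX', mvfderiv_eq_chart hp hY']
  have h1 := TangentBundle.continuousLinearMapAt_trivializationAt (I := I) hp
  obtain ⟨L, hL⟩ := isInvertible_mfderiv_extChartAt (I := I)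
    (show p ∈ (extChartAt I p₀).source by rwa [extChartAt_source])
  have h0 : (extChartAt I p₀).symm (extChartAt I p₀ p) = p :=
    (extChartAt I p₀).left_inv (by rwa [extChartAt_source])
  rw [← hL, ContinuousLinearMap.inverse_equiv]
  have h2 : ∀ v, T.continuousLinearMapAt ℝ p (L.symm v) = v := by
    intro v
    exact (DFunLike.congr_fun h1 (L.symm v)).trans
      ((DFunLike.congr_fun hL.symm (L.symm v)).trans (L.apply_symm_apply v))
  refine (h2 _).trans ?_
  change fderiv ℝ (y ∘ ψ.symm) (ψ p) (x (ψ.symm (ψ p))) - fderiv ℝ (x ∘ ψ.symm) (ψ p)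
    (y (ψ.symm (ψ p))) = _
  rw [hψ, h0]

end Chart

/-! ### The puzzle on the tangent bundle over a chart domain, from its coefficients. -/

section ChartPuzzle

set_option maxSynthPendingDepth 3
set_option linter.unusedSectionVars false

variable {E : Type*} [NormedAddCommGroup E] [NormedSpace ℝ E] [FiniteDimensional ℝ E]
  {H : Type*} [TopologicalSpace H] {I : ModelWithCorners ℝ E H} [I.Boundaryless]
  {M : Type*} [TopologicalSpace M] [ChartedSpace H M] [IsManifold I ∞ M]

/-- The metric on the domain of a chart with given coefficients. -/
def chartMetric (p₀ : M) (G : E → E →L[ℝ] E →L[ℝ] ℝ) (p : M) :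
    TangentSpace I p →L[ℝ] TangentSpace I p →L[ℝ] ℝ :=
  (ContinuousLinearMap.precomp ℝ ((tangentTriv E I M p₀).continuousLinearMapAt ℝ p)) ∘L
    (G (extChartAt I p₀ p) ∘L (tangentTriv E I M p₀).continuousLinearMapAt ℝ p)

/-- The connection on the domain of a chart with given Christoffel symbols. -/
def chartNabla (p₀ : M) (Γ : E → E →L[ℝ] E →L[ℝ] E) (σ : Π x : M, TangentSpace I x) (p : M) :
    TangentSpace I p →L[ℝ] TangentSpace I p :=
  (tangentTriv E I M p₀).symmL ℝ p ∘L
    -- This is `dσ + Γ(·, σ)` in coordinates; the flip appears because the first slot of `Γ` is the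
    -- direction.
    (fderiv ℝ ((fun q ↦ (tangentTriv E I M p₀).continuousLinearMapAt ℝ q (σ q)) ∘
        (extChartAt I p₀).symm) (extChartAt I p₀ p) +
      (Γ (extChartAt I p₀ p)).flip ((tangentTriv E I M p₀).continuousLinearMapAt ℝ p (σ p))) ∘L
    (tangentTriv E I M p₀).continuousLinearMapAt ℝ p

variable {p₀ p : M} {G : E → E →L[ℝ] E →L[ℝ] ℝ} {Γ : E → E →L[ℝ] E →L[ℝ] E}

theorem chartMetric_apply (v w : TangentSpace I p) :
    chartMetric p₀ G p v w = G (extChartAt I p₀ p)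
      ((tangentTriv E I M p₀).continuousLinearMapAt ℝ p v)
      ((tangentTriv E I M p₀).continuousLinearMapAt ℝ p w) := rfl

theorem continuousLinearMapAt_chartNabla (hp : p ∈ (chartAt H p₀).source)
    (σ : Π x : M, TangentSpace I x) (ξ : TangentSpace I p) :
    (tangentTriv E I M p₀).continuousLinearMapAt ℝ p (chartNabla p₀ Γ σ p ξ) =
      fderiv ℝ ((fun q ↦ (tangentTriv E I M p₀).continuousLinearMapAt ℝ q (σ q)) ∘
        (extChartAt I p₀).symm) (extChartAt I p₀ p)
        ((tangentTriv E I M p₀).continuousLinearMapAt ℝ p ξ) +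
      Γ (extChartAt I p₀ p) ((tangentTriv E I M p₀).continuousLinearMapAt ℝ p ξ)
        ((tangentTriv E I M p₀).continuousLinearMapAt ℝ p (σ p)) :=
  (tangentTriv E I M p₀).continuousLinearMapAt_symmL hp _

/-- For differentiable `σ` the derivative in the chart is replaced by the intrinsic one, the form
suited to Lie brackets and to the chain rule along a map into the manifold. -/
theorem chartNabla_apply (hp : p ∈ (chartAt H p₀).source) (σ : Π x : M, TangentSpace I x)
    (hσ : MDifferentiableAt I (I.prod 𝓘(ℝ, E)) (fun y ↦ TotalSpace.mk' E y (σ y)) p)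
    (ξ : TangentSpace I p) :
    (tangentTriv E I M p₀).continuousLinearMapAt ℝ p (chartNabla p₀ Γ σ p ξ) =
      mvfderiv I (fun q ↦ (tangentTriv E I M p₀).continuousLinearMapAt ℝ q (σ q)) p ξ +
      Γ (extChartAt I p₀ p) ((tangentTriv E I M p₀).continuousLinearMapAt ℝ p ξ)
        ((tangentTriv E I M p₀).continuousLinearMapAt ℝ p (σ p)) := by
  rw [mvfderiv_eq_chart hp ((mdifferentiableAt_section_iff_clmAt _ hp σ).1 hσ)]
  exact continuousLinearMapAt_chartNabla hp σ ξ

theorem tangentTriv_injective (hp : p ∈ (chartAt H p₀).source) :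
    Function.Injective ((tangentTriv E I M p₀).continuousLinearMapAt ℝ p) := by
  intro v w hvw
  have h1 := congrArg ((tangentTriv E I M p₀).symmL ℝ p) hvw
  rwa [Trivialization.symmL_continuousLinearMapAt _ hp,
    Trivialization.symmL_continuousLinearMapAt _ hp] at h1

theorem contMDiffAt_chartMetric (hp : p ∈ (chartAt H p₀).source)
    (hG : ContDiffAt ℝ ∞ G (extChartAt I p₀ p)) :
    ContMDiffAt I (I.prod 𝓘(ℝ, E →L[ℝ] E →L[ℝ] ℝ)) ∞
      (fun x ↦ TotalSpace.mk' (E →L[ℝ] E →L[ℝ] ℝ) x (chartMetric (I := I) p₀ G x)) p := by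
  refine contMDiffAt_hom_of_apply (tangentTriv E I M p₀) hp (F₂ := E →L[ℝ] ℝ)
    (V₂ := fun x ↦ TangentSpace I x →L[ℝ] Bundle.Trivial M ℝ x) _ fun v ↦ ?_
  refine contMDiffAt_hom_of_apply (tangentTriv E I M p₀) hp (F₂ := ℝ)
    (V₂ := Bundle.Trivial M ℝ) _ fun w ↦ ?_
  rw [contMDiffAt_section]
  have h1 : ContMDiffAt I 𝓘(ℝ, ℝ) ∞ ((fun x ↦ G x v w) ∘ extChartAt I p₀) p :=
    contMDiffAt_comp_chart hp ((hG.clm_apply contDiffAt_const).clm_apply contDiffAt_const)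
  refine h1.congr_of_eventuallyEq ?_
  filter_upwards [(chartAt H p₀).open_source.mem_nhds hp] with q hq
  change chartMetric p₀ G q _ _ = _
  rw [chartMetric_apply, Trivialization.continuousLinearMapAt_symmL _ hq,
    Trivialization.continuousLinearMapAt_symmL _ hq]
  rfl

theorem contMDiffAt_chartNabla (hp : p ∈ (chartAt H p₀).source)
    (hΓ : ContDiffAt ℝ ∞ Γ (extChartAt I p₀ p)) (σ : Π x : M, TangentSpace I x)
    (hσ : ContMDiffAt I (I.prod 𝓘(ℝ, E)) ∞ (fun y ↦ TotalSpace.mk' E y (σ y)) p) :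
    ContMDiffAt I (I.prod 𝓘(ℝ, E →L[ℝ] E)) ∞
      (fun y ↦ TotalSpace.mk' (E →L[ℝ] E) y (chartNabla p₀ Γ σ y)) p := by
  refine contMDiffAt_hom_of_apply (tangentTriv E I M p₀) hp (F₂ := E)
    (V₂ := (TangentSpace I : M → Type _)) _ fun v ↦ ?_
  rw [contMDiffAt_section_iff_clmAt (tangentTriv E I M p₀) hp]
  have hs := (contMDiffAt_section_iff_clmAt (tangentTriv E I M p₀) hp σ).1 hσ
  have hs' := contDiffAt_chart hp hs
  have h1 : ContDiffAt ℝ ∞ (fderiv ℝ ((fun q ↦ (tangentTriv E I M p₀).continuousLinearMapAt ℝ q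
      (σ q)) ∘ (extChartAt I p₀).symm)) (extChartAt I p₀ p) := hs'.fderiv_right (by simp)
  have h2 := contMDiffAt_comp_chart hp (h1.clm_apply (contDiffAt_const (c := v)))
  have h3 := (contMDiffAt_comp_chart hp (hΓ.clm_apply (contDiffAt_const (c := v)))).clm_apply hs
  refine (h2.add h3).congr_of_eventuallyEq ?_
  filter_upwards [(chartAt H p₀).open_source.mem_nhds hp] with q hq
  rw [continuousLinearMapAt_chartNabla hq, Trivialization.continuousLinearMapAt_symmL _ hq]
  rfl

theorem isCovariantDerivativeOn_chartNabla :
    IsCovariantDerivativeOn E (chartNabla (I := I) p₀ Γ) (chartAt H p₀).source where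
  add {σ τ p} hσ hτ hp := by
    have hs := differentiableAt_chart hp ((mdifferentiableAt_section_iff_clmAt
      (tangentTriv E I M p₀) hp σ).1 hσ)
    have ht := differentiableAt_chart hp ((mdifferentiableAt_section_iff_clmAt
      (tangentTriv E I M p₀) hp τ).1 hτ)
    have h1 : ((fun q ↦ (tangentTriv E I M p₀).continuousLinearMapAt ℝ q ((σ + τ) q)) ∘
        (extChartAt I p₀).symm) = ((fun q ↦ (tangentTriv E I M p₀).continuousLinearMapAt ℝ q
        (σ q)) ∘ (extChartAt I p₀).symm) + ((fun q ↦ (tangentTriv E I M p₀).continuousLinearMapAt ℝ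
        q (τ q)) ∘ (extChartAt I p₀).symm) := by
      funext v
      exact map_add _ _ _
    ext ξ
    apply tangentTriv_injective hp
    rw [add_apply, map_add, continuousLinearMapAt_chartNabla hp,
      continuousLinearMapAt_chartNabla hp, continuousLinearMapAt_chartNabla hp, h1,
      fderiv_add hs ht, Pi.add_apply, map_add, map_add, add_apply]
    abel
  leibniz {σ g p} hσ hg hp := by
    have hs' := (mdifferentiableAt_section_iff_clmAt (tangentTriv E I M p₀) hp σ).1 hσ
    have hs := differentiableAt_chart hp hs'
    have hg' := differentiableAt_chart hp hg
    have h1 : ((fun q ↦ (tangentTriv E I M p₀).continuousLinearMapAt ℝ q ((g • σ) q)) ∘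
        (extChartAt I p₀).symm) = (g ∘ (extChartAt I p₀).symm) • ((fun q ↦
        (tangentTriv E I M p₀).continuousLinearMapAt ℝ q (σ q)) ∘ (extChartAt I p₀).symm) := by
      funext v
      exact map_smul _ _ _
    have h0 : (extChartAt I p₀).symm (extChartAt I p₀ p) = p :=
      (extChartAt I p₀).left_inv (by rwa [extChartAt_source])
    ext ξ
    apply tangentTriv_injective hp
    have h2 : (g ∘ (extChartAt I p₀).symm) (extChartAt I p₀ p) = g p := congrArg g h0
    have h3 : ((fun q ↦ (tangentTriv E I M p₀).continuousLinearMapAt ℝ q (σ q)) ∘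
        (extChartAt I p₀).symm) (extChartAt I p₀ p) =
        (tangentTriv E I M p₀).continuousLinearMapAt ℝ p (σ p) :=
      congrArg (fun q ↦ (tangentTriv E I M p₀).continuousLinearMapAt ℝ q (σ q)) h0
    have h4 : (g • σ) p = g p • σ p := rfl
    rw [add_apply, map_add, smul_apply, map_smul, ContinuousLinearMap.smulRight_apply, map_smul,
      continuousLinearMapAt_chartNabla hp, continuousLinearMapAt_chartNabla hp, h1,
      fderiv_smul hg' hs, mvfderiv_eq_chart hp hg, h4, map_smul, map_smul, h2, h3, add_apply,
      smul_apply, ContinuousLinearMap.smulRight_apply, smul_add]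
    abel

/-- The puzzle on the tangent bundle over the domain of a chart, with given coefficients of the
metric and given Christoffel symbols. -/
def chartPuzzle (p₀ : M) (G : E → E →L[ℝ] E →L[ℝ] ℝ) (Γ : E → E →L[ℝ] E →L[ℝ] E)
    (hG : ContDiffOn ℝ ∞ G (extChartAt I p₀).target)
    (hΓ : ContDiffOn ℝ ∞ Γ (extChartAt I p₀).target)
    (hs : ∀ u ∈ (extChartAt I p₀).target, ∀ b c, G u b c = G u c b)
    (hpos : ∀ u ∈ (extChartAt I p₀).target, ∀ b, b ≠ 0 → 0 < G u b b)
    (hcompat : ∀ u ∈ (extChartAt I p₀).target, ∀ a b c,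
      fderiv ℝ G u a b c = G u (Γ u a b) c + G u b (Γ u a c)) :
    RiemannianPuzzle I E (TangentSpace I : M → Type _) (chartAt H p₀).source where
  g := chartMetric p₀ G
  nabla := chartNabla p₀ Γ
  φ x := ContinuousLinearMap.id ℝ (TangentSpace I x)
  isOpen := (chartAt H p₀).open_source
  g_symm x hx v w := hs _ ((extChartAt I p₀).map_source (by rwa [extChartAt_source])) _ _
  g_pos x hx v hv := hpos _ ((extChartAt I p₀).map_source (by rwa [extChartAt_source])) _
    ((map_ne_zero_iff _ (tangentTriv_injective hx)).2 hv)
  g_smooth x hx := (contMDiffAt_chartMetric hx (hG.contDiffAt ((isOpen_extChartAt_target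
    p₀).mem_nhds ((extChartAt I p₀).map_source (by rwa [extChartAt_source]))))).contMDiffWithinAt
  nabla_isCovariantDerivative := isCovariantDerivativeOn_chartNabla
  nabla_smooth x hx σ hσ := contMDiffAt_chartNabla hx (hΓ.contDiffAt ((isOpen_extChartAt_target
    p₀).mem_nhds ((extChartAt I p₀).map_source (by rwa [extChartAt_source])))) σ hσ
  nabla_metric := by
    intro x hx σ τ hσ hτ ξ
    have hx' : x ∈ (extChartAt I p₀).source := by rwa [extChartAt_source]
    have hu := (extChartAt I p₀).map_source hx'
    have hGx : ContDiffAt ℝ ∞ G (extChartAt I p₀ x) :=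
      hG.contDiffAt ((isOpen_extChartAt_target p₀).mem_nhds hu)
    have h0 : (extChartAt I p₀).symm (extChartAt I p₀ x) = x := (extChartAt I p₀).left_inv hx'
    have hs' := (mdifferentiableAt_section_iff_clmAt (tangentTriv E I M p₀) hx σ).1 hσ
    have ht' := (mdifferentiableAt_section_iff_clmAt (tangentTriv E I M p₀) hx τ).1 hτ
    have hs := differentiableAt_chart hx hs'
    have ht := differentiableAt_chart hx ht'
    have hm : MDifferentiableAt I 𝓘(ℝ, ℝ) (fun y ↦ chartMetric p₀ G y (σ y) (τ y)) x :=
      (((contMDiffAt_comp_chart hx hGx).mdifferentiableAt (by simp)).clm_apply hs').clm_apply ht'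
    have h1 : (fun y ↦ chartMetric p₀ G y (σ y) (τ y)) ∘ (extChartAt I p₀).symm
        =ᶠ[𝓝 (extChartAt I p₀ x)] fun u ↦ G u
          (((fun q ↦ (tangentTriv E I M p₀).continuousLinearMapAt ℝ q (σ q)) ∘
            (extChartAt I p₀).symm) u)
          (((fun q ↦ (tangentTriv E I M p₀).continuousLinearMapAt ℝ q (τ q)) ∘
            (extChartAt I p₀).symm) u) := by
      filter_upwards [(isOpen_extChartAt_target p₀).mem_nhds hu] with u hu
      rw [Function.comp_apply, chartMetric_apply, (extChartAt I p₀).right_inv hu]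
      rfl
    have h2 := ((hGx.differentiableAt (by simp)).hasFDerivAt.clm_apply hs.hasFDerivAt).clm_apply
      ht.hasFDerivAt
    have h3 : ∀ σ : Π x : M, TangentSpace I x, ((fun q ↦ (tangentTriv E I M
        p₀).continuousLinearMapAt ℝ q (σ q)) ∘ (extChartAt I p₀).symm) (extChartAt I p₀ x) =
        (tangentTriv E I M p₀).continuousLinearMapAt ℝ x (σ x) := fun σ ↦
      congrArg (fun q ↦ (tangentTriv E I M p₀).continuousLinearMapAt ℝ q (σ q)) h0
    rw [h3, h3] at h2
    rw [mvfderiv_eq_chart hx hm, h1.fderiv_eq, h2.fderiv, chartMetric_apply, chartMetric_apply,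
      chartNabla_apply hx σ hσ, chartNabla_apply hx τ hτ, mvfderiv_eq_chart hx hs',
      mvfderiv_eq_chart hx ht']
    -- Of the three terms of the product rule, the one differentiating `G` is turned by `hcompat`
    -- into the two `Γ` terms of the covariant derivatives.
    simp only [map_add, add_apply, ContinuousLinearMap.comp_apply, ContinuousLinearMap.flip_apply,
      hcompat _ hu]
    ring
  φ_smooth x hx := by
    refine (contMDiffAt_hom_of_apply (tangentTriv E I M p₀) hx (F₂ := E)
      (V₂ := (TangentSpace I : M → Type _)) _ fun v ↦ ?_).contMDiffWithinAt
    exact (RiemannianPuzzle.contMDiffOn_symmL_apply (tangentTriv E I M p₀) v).contMDiffAt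
      ((tangentTriv E I M p₀).open_baseSet.mem_nhds hx)

/-- In coordinates the derivative terms of `∇_X Y - ∇_Y X` form the bracket, and the torsion is
`Γ(X, Y) - Γ(Y, X)`. -/
theorem isLeviCivita_chartPuzzle {hG hΓ hs hpos hcompat}
    (hΓs : ∀ u ∈ (extChartAt I p₀).target, ∀ a b, Γ u a b = Γ u b a) :
    (chartPuzzle (I := I) p₀ G Γ hG hΓ hs hpos hcompat).IsLeviCivita := by
  intro x hx X Y hX hY
  apply tangentTriv_injective hx
  rw [mlieBracket_eq_chart hx X Y hX hY, map_sub]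
  change (tangentTriv E I M p₀).continuousLinearMapAt ℝ x (chartNabla p₀ Γ Y x (X x)) -
    (tangentTriv E I M p₀).continuousLinearMapAt ℝ x (chartNabla p₀ Γ X x (Y x)) = _
  rw [chartNabla_apply hx Y hY, chartNabla_apply hx X hX,
    hΓs _ ((extChartAt I p₀).map_source (by rwa [extChartAt_source]))]
  abel

end ChartPuzzle

/-! ### Smooth frames and the connection form of a covariant derivative. -/

section Frame

set_option maxSynthPendingDepth 3
set_option linter.unusedSectionVars false

variable {E : Type*} [NormedAddCommGroup E] [NormedSpace ℝ E] [FiniteDimensional ℝ E]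
  {H : Type*} [TopologicalSpace H] {I : ModelWithCorners ℝ E H} [I.Boundaryless]
  {M : Type*} [TopologicalSpace M] [ChartedSpace H M] [IsManifold I ∞ M]
  {F : Type*} [NormedAddCommGroup F] [NormedSpace ℝ F] [FiniteDimensional ℝ F]
  {V : M → Type*} [TopologicalSpace (TotalSpace F V)]
  [∀ x, AddCommGroup (V x)] [∀ x, Module ℝ (V x)] [∀ x, TopologicalSpace (V x)]
  [∀ x, IsTopologicalAddGroup (V x)] [∀ x, ContinuousSMul ℝ (V x)]
  [FiberBundle F V] [VectorBundle ℝ F V] [ContMDiffVectorBundle ∞ F V I]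
  {W : Type*} [NormedAddCommGroup W] [NormedSpace ℝ W] [FiniteDimensional ℝ W]

/-- The coordinates of the vectors of `V` in the frame `B`. -/
def frameCoord (e : Trivialization F (TotalSpace.proj : TotalSpace F V → M))
    [MemTrivializationAtlas e] (B : Π x : M, W →L[ℝ] V x) (x : M) : V x →L[ℝ] W :=
  -- The detour through `e` means that the inverted map goes between the fixed spaces `W` and `F`,
  -- where inversion is known to be smooth.
  (e.continuousLinearMapAt ℝ x ∘L B x).inverse ∘L e.continuousLinearMapAt ℝ x

variable (I) in
/-- `B` is a smooth frame of the bundle `V` over the open set `O`. -/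
structure IsSmoothFrame (e : Trivialization F (TotalSpace.proj : TotalSpace F V → M))
    (B : Π x : M, W →L[ℝ] V x) (O : Set M) : Prop where
  isOpen : IsOpen O
  subset : O ⊆ e.baseSet
  smooth : ∀ w, ContMDiffOn I (I.prod 𝓘(ℝ, F)) ∞ (fun x ↦ TotalSpace.mk' F x (B x w)) O
  bijective : ∀ x ∈ O, Function.Bijective (B x)

variable {e : Trivialization F (TotalSpace.proj : TotalSpace F V → M)}
  [MemTrivializationAtlas e] {B : Π x : M, W →L[ℝ] V x} {O : Set M} {x : M}

namespace IsSmoothFrame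

theorem isInvertible (hB : IsSmoothFrame I e B O) (hx : x ∈ O) :
    (e.continuousLinearMapAt ℝ x ∘L B x).IsInvertible := by
  have he : Function.Bijective (e.continuousLinearMapAt ℝ x) := by
    have := (e.continuousLinearEquivAt ℝ x (hB.subset hx)).bijective
    convert this using 1
    funext v
    rw [Trivialization.continuousLinearMapAt_apply, e.coe_linearMapAt_of_mem (hB.subset hx)]
    rfl
  let L := (LinearEquiv.ofBijective (e.continuousLinearMapAt ℝ x ∘L B x).toLinearMap
    (he.comp (hB.bijective x hx))).toContinuousLinearEquiv
  exact ⟨L, rfl⟩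

theorem frameCoord_apply (hB : IsSmoothFrame I e B O) (hx : x ∈ O) (w : W) :
    frameCoord e B x (B x w) = w := by
  obtain ⟨L, hL⟩ := hB.isInvertible hx
  have h1 : e.continuousLinearMapAt ℝ x (B x w) = L w := (DFunLike.congr_fun hL w).symm
  rw [frameCoord, ContinuousLinearMap.comp_apply, h1, ← hL, ContinuousLinearMap.inverse_equiv]
  exact L.symm_apply_apply w

theorem apply_frameCoord (hB : IsSmoothFrame I e B O) (hx : x ∈ O) (v : V x) :
    B x (frameCoord e B x v) = v := by
  obtain ⟨w, rfl⟩ := (hB.bijective x hx).2 v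
  rw [hB.frameCoord_apply hx]

theorem frameCoord_bijective (hB : IsSmoothFrame I e B O) (hx : x ∈ O) :
    Function.Bijective (frameCoord e B x) :=
  ⟨Function.LeftInverse.injective (hB.apply_frameCoord hx),
    Function.RightInverse.surjective (hB.frameCoord_apply hx)⟩

theorem contMDiffAt_inverse (hB : IsSmoothFrame I e B O) (hx : x ∈ O) :
    ContMDiffAt I 𝓘(ℝ, F →L[ℝ] W) ∞ (fun y ↦ (e.continuousLinearMapAt ℝ y ∘L B y).inverse) x := by
  have h1 : ContMDiffAt I 𝓘(ℝ, W →L[ℝ] F) ∞ (fun y ↦ e.continuousLinearMapAt ℝ y ∘L B y) x :=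
    contMDiffAt_of_apply fun w ↦ (contMDiffAt_section_iff_clmAt e (hB.subset hx) _).1
      ((hB.smooth w).contMDiffAt (hB.isOpen.mem_nhds hx))
  exact ((hB.isInvertible hx).contDiffAt_map_inverse (n := ∞)).contMDiffAt.comp x h1

theorem contMDiffAt_frameCoord (hB : IsSmoothFrame I e B O) (hx : x ∈ O) (σ : Π x : M, V x)
    (hσ : ContMDiffAt I (I.prod 𝓘(ℝ, F)) ∞ (fun y ↦ TotalSpace.mk' F y (σ y)) x) :
    ContMDiffAt I 𝓘(ℝ, W) ∞ (fun y ↦ frameCoord e B y (σ y)) x :=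
  (hB.contMDiffAt_inverse hx).clm_apply
    ((contMDiffAt_section_iff_clmAt e (hB.subset hx) _).1 hσ)

theorem mdifferentiableAt_frameCoord (hB : IsSmoothFrame I e B O) (hx : x ∈ O) (σ : Π x : M, V x)
    (hσ : MDifferentiableAt I (I.prod 𝓘(ℝ, F)) (fun y ↦ TotalSpace.mk' F y (σ y)) x) :
    MDifferentiableAt I 𝓘(ℝ, W) (fun y ↦ frameCoord e B y (σ y)) x :=
  ((hB.contMDiffAt_inverse hx).mdifferentiableAt (by simp)).clm_apply
    ((mdifferentiableAt_section_iff_clmAt e (hB.subset hx) _).1 hσ)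

end IsSmoothFrame

/-- Additivity of a covariant derivative requires differentiable summands, so differentiability of
the partial sums is carried through the induction. -/
theorem isCovariantDerivativeOn_sum {cov : (Π x : M, V x) → (Π x : M, TangentSpace I x →L[ℝ] V x)}
    (hcov : IsCovariantDerivativeOn F cov O) (hx : x ∈ O) {ι : Type*} (t : Finset ι)
    (σ : ι → Π x : M, V x)
    (hσ : ∀ i, MDifferentiableAt I (I.prod 𝓘(ℝ, F)) (fun y ↦ TotalSpace.mk' F y (σ i y)) x) :
    MDifferentiableAt I (I.prod 𝓘(ℝ, F)) (fun y ↦ TotalSpace.mk' F y ((∑ i ∈ t, σ i) y)) x ∧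
      cov (∑ i ∈ t, σ i) x = ∑ i ∈ t, cov (σ i) x := by
  classical
  induction t using Finset.induction_on with
  | empty => exact ⟨by simpa using! mdifferentiableAt_zeroSection .., by simpa using! hcov.zero hx⟩
  | insert i t hi ih =>
    rw [Finset.sum_insert hi, Finset.sum_insert hi]
    exact ⟨mdifferentiableAt_add_section (hσ i) ih.1, by rw [hcov.add (hσ i) ih.1 hx, ih.2]⟩

/-- The connection form in the frame `B` of the covariant derivative `cov`, read in the chart at
`x₀`. -/
def frameForm (x₀ : M) (e : Trivialization F (TotalSpace.proj : TotalSpace F V → M))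
    [MemTrivializationAtlas e] (B : Π x : M, W →L[ℝ] V x)
    (cov : (Π x : M, V x) → (Π x : M, TangentSpace I x →L[ℝ] V x)) (x : M) : W →L[ℝ] E →L[ℝ] W :=
  -- Expanding in a basis of `W` makes the form linear in the frame vector by construction. The
  -- first slot is the frame vector, the second the direction.
  ∑ i, ContinuousLinearMap.smulRightL ℝ W (E →L[ℝ] W)
    (LinearMap.toContinuousLinearMap ((Module.finBasis ℝ W).coord i))
    (frameCoord e B x ∘L cov (fun y ↦ B y (Module.finBasis ℝ W i)) x ∘L
      (tangentTriv E I M x₀).symmL ℝ x)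

variable {cov : (Π x : M, V x) → (Π x : M, TangentSpace I x →L[ℝ] V x)} {x₀ : M}

theorem frameForm_apply (w : W) (v : E) :
    frameForm x₀ e B cov x w v = ∑ i, (Module.finBasis ℝ W).coord i w •
      frameCoord e B x (cov (fun y ↦ B y (Module.finBasis ℝ W i)) x
        ((tangentTriv E I M x₀).symmL ℝ x v)) := by
  simp [frameForm]

theorem IsSmoothFrame.contMDiffAt_frameForm (hB : IsSmoothFrame I e B O) (hx : x ∈ O)
    (hO : O ⊆ (chartAt H x₀).source)
    (hcov : ∀ σ : Π x : M, V x,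
      ContMDiffAt I (I.prod 𝓘(ℝ, F)) ∞ (fun y ↦ TotalSpace.mk' F y (σ y)) x →
      ContMDiffAt I (I.prod 𝓘(ℝ, E →L[ℝ] F)) ∞ (fun y ↦ TotalSpace.mk' (E →L[ℝ] F) y (cov σ y)) x) :
    ContMDiffAt I 𝓘(ℝ, W →L[ℝ] E →L[ℝ] W) ∞ (frameForm x₀ e B cov) x := by
  refine contMDiffAt_of_apply fun w ↦ contMDiffAt_of_apply fun v ↦ ?_
  simp only [frameForm_apply]
  refine contMDiffAt_finsetSum fun i _ ↦ ContMDiffAt.clm_apply (contMDiffAt_const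
    (c := (Module.finBasis ℝ W).coord i w • ContinuousLinearMap.id ℝ W)) ?_
  refine hB.contMDiffAt_frameCoord hx (fun y ↦ cov (fun y ↦ B y (Module.finBasis ℝ W i)) y
    ((tangentTriv E I M x₀).symmL ℝ y v)) ?_
  exact (hcov _ ((hB.smooth _).contMDiffAt (hB.isOpen.mem_nhds hx))).clm_bundle_apply
    ((RiemannianPuzzle.contMDiffOn_symmL_apply (tangentTriv E I M x₀) v).contMDiffAt
      ((tangentTriv E I M x₀).open_baseSet.mem_nhds (hO hx)))

/-- A covariant derivative is expressed in a frame by its connection form. -/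
theorem IsSmoothFrame.frameCoord_cov (hB : IsSmoothFrame I e B O) (hx : x ∈ O)
    (hO : O ⊆ (chartAt H x₀).source) (hcov : IsCovariantDerivativeOn F cov O) (σ : Π x : M, V x)
    (hσ : MDifferentiableAt I (I.prod 𝓘(ℝ, F)) (fun y ↦ TotalSpace.mk' F y (σ y)) x)
    (ξ : TangentSpace I x) :
    frameCoord e B x (cov σ x ξ) = mvfderiv I (fun y ↦ frameCoord e B y (σ y)) x ξ +
      frameForm x₀ e B cov x (frameCoord e B x (σ x))
        ((tangentTriv E I M x₀).continuousLinearMapAt ℝ x ξ) := by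
  set b := Module.finBasis ℝ W with hb
  set s : M → W := fun y ↦ frameCoord e B y (σ y) with hs
  have hsd : MDifferentiableAt I 𝓘(ℝ, W) s x := hB.mdifferentiableAt_frameCoord hx σ hσ
  let c : ∀ i, W →L[ℝ] ℝ := fun i ↦ LinearMap.toContinuousLinearMap (b.coord i)
  have hc : ∀ i, HasMFDerivAt I 𝓘(ℝ, ℝ) (fun y ↦ c i (s y)) x (c i ∘L mvfderiv I s x) := fun i ↦
    (c i).hasMFDerivAt.comp x hsd.hasMFDerivAt
  have hcd : ∀ i, MDifferentiableAt I 𝓘(ℝ, ℝ) (fun y ↦ c i (s y)) x := fun i ↦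
    (hc i).mdifferentiableAt
  have hBd : ∀ i, MDifferentiableAt I (I.prod 𝓘(ℝ, F)) (fun y ↦ TotalSpace.mk' F y (B y (b i))) x :=
    fun i ↦ ((hB.smooth (b i)).contMDiffAt (hB.isOpen.mem_nhds hx)).mdifferentiableAt (by simp)
  have hsum := isCovariantDerivativeOn_sum hcov hx Finset.univ
    (fun i ↦ (fun y ↦ c i (s y)) • fun y ↦ B y (b i)) (fun i ↦ (hcd i).smul_section (hBd i))
  -- Near `x` the section is a combination of the frame sections `B (b i)` with function
  -- coefficients. Locality of `cov` and the Leibniz rule, term by term, give the formula.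
  have heq : ∀ᶠ y in 𝓝 x, σ y = (∑ i, (fun y ↦ c i (s y)) • fun y ↦ B y (b i)) y := by
    filter_upwards [hB.isOpen.mem_nhds hx] with y hy
    rw [Finset.sum_apply]
    have h1 : ∀ i, ((fun y ↦ c i (s y)) • fun y ↦ B y (b i)) y = B y (c i (s y) • b i) := fun i ↦
      (map_smul (B y) (c i (s y)) (b i)).symm
    simp only [h1]
    rw [← map_sum, show ∑ i, c i (s y) • b i = s y from b.sum_repr (s y)]
    exact (hB.apply_frameCoord hy (σ y)).symm
  rw [hcov.congr_of_eventuallyEq hσ hsum.1 (hB.isOpen.mem_nhds hx) heq, hsum.2, frameForm_apply,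
    Trivialization.symmL_continuousLinearMapAt _ (hO hx), sum_apply, map_sum]
  have h2 : ∀ i, frameCoord e B x (cov ((fun y ↦ c i (s y)) • fun y ↦ B y (b i)) x ξ) =
      c i (mvfderiv I s x ξ) • b i +
        c i (s x) • frameCoord e B x (cov (fun y ↦ B y (b i)) x ξ) := by
    intro i
    have h3 : mvfderiv I (fun y ↦ c i (s y)) x ξ = c i (mvfderiv I s x ξ) :=
      DFunLike.congr_fun (hc i).mfderiv ξ
    rw [hcov.leibniz (hBd i) (hcd i) hx, add_apply, map_add, ContinuousLinearMap.smulRight_apply,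
      map_smul, hB.frameCoord_apply hx, h3, add_comm, smul_apply, map_smul]
  simp only [h2]
  rw [Finset.sum_add_distrib, show ∑ i, c i (mvfderiv I s x ξ) • b i = mvfderiv I s x ξ from
    b.sum_repr _]
  rfl

end Frame

/-! ### The frame adapted to `φ(TM) ⊕ NM`, and the symmetric extension of its connection form. -/

section NormalFrame

set_option maxSynthPendingDepth 3
set_option linter.unusedSectionVars false

variable {E : Type*} [NormedAddCommGroup E] [NormedSpace ℝ E] [FiniteDimensional ℝ E]
  {H : Type*} [TopologicalSpace H] {I : ModelWithCorners ℝ E H} [I.Boundaryless]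
  {M : Type*} [TopologicalSpace M] [ChartedSpace H M] [IsManifold I ∞ M]
  {F : Type*} [NormedAddCommGroup F] [NormedSpace ℝ F] [FiniteDimensional ℝ F]
  {V : M → Type*} [TopologicalSpace (TotalSpace F V)]
  [∀ x, AddCommGroup (V x)] [∀ x, Module ℝ (V x)] [∀ x, TopologicalSpace (V x)]
  [∀ x, IsTopologicalAddGroup (V x)] [∀ x, ContinuousSMul ℝ (V x)]
  [FiberBundle F V] [VectorBundle ℝ F V] [ContMDiffVectorBundle ∞ F V I]

namespace RiemannianPuzzle

variable (P : RiemannianPuzzle I F V univ) (h : P.IsInjective) (x₀ : M)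

/-- The frame of `V` adapted to the decomposition `V = φ(TM) ⊕ NM`, around `x₀`. -/
def normalFrame (x : M) : (E × NormalModel E F) →L[ℝ] V x :=
  (P.φ x ∘L (tangentTriv E I M x₀).symmL ℝ x).coprod (P.normalSymm h x₀ x)

variable {x₀} {x : M}

theorem normalFrame_apply (e : E) (k : NormalModel E F) :
    P.normalFrame h x₀ x (e, k) =
      P.φ x ((tangentTriv E I M x₀).symmL ℝ x e) + P.normalSymm h x₀ x k := by
  simp [normalFrame]

theorem normalFrame_apply_left (e : E) :
    P.normalFrame h x₀ x (e, 0) = P.φ x ((tangentTriv E I M x₀).symmL ℝ x e) := by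
  rw [normalFrame_apply, map_zero, add_zero]

theorem normalBaseSet_subset_source : P.normalBaseSet h x₀ ⊆ (chartAt H x₀).source :=
  fun _ hx ↦ hx.1.2

theorem normalBaseSet_subset_baseSet :
    P.normalBaseSet h x₀ ⊆ (trivializationAt F V x₀).baseSet := fun _ hx ↦ hx.1.1

theorem normalSymm_injective (hx : x ∈ P.normalBaseSet h x₀) :
    Function.Injective (P.normalSymm h x₀ x) := by
  intro k k' hk
  have h1 := congrArg (fun v ↦ (P.adapted h x₀ x ((trivializationAt F V x₀).continuousLinearMapAt ℝ
    x v)).1) hk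
  simp only [normalSymm, ContinuousLinearMap.comp_apply] at h1
  rwa [Trivialization.continuousLinearMapAt_symmL _ hx.1.1,
    Trivialization.continuousLinearMapAt_symmL _ hx.1.1, P.adapted_inverse h hx,
    P.adapted_inverse h hx] at h1

/-- If `φ(v) + n = 0` with `n` normal, then `φ(v) = -n` is orthogonal to itself, hence zero; both
components then vanish by injectivity. -/
theorem normalFrame_injective (hx : x ∈ P.normalBaseSet h x₀) :
    Function.Injective (P.normalFrame h x₀ x) := by
  refine (injective_iff_map_eq_zero _).2 ?_
  rintro ⟨e, k⟩ hek
  rw [normalFrame_apply] at hek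
  set v := (tangentTriv E I M x₀).symmL ℝ x e with hv
  have h1 := P.normalSymm_mem h hx k v
  rw [eq_neg_of_add_eq_zero_right hek, map_neg, neg_apply, neg_eq_zero] at h1
  have h2 : P.φ x v = 0 := by
    by_contra hne
    exact (P.g_pos x trivial _ hne).ne' h1
  have h3 : v = 0 := h x trivial (by rw [h2, map_zero])
  have h4 : e = 0 := by
    rw [← (tangentTriv E I M x₀).continuousLinearMapAt_symmL (R := ℝ) hx.1.2 e, ← hv, h3, map_zero]
  rw [h2, zero_add] at hek
  rw [h4, P.normalSymm_injective h hx (hek.trans (map_zero _).symm), Prod.mk_zero_zero]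

theorem clmAt_injective {e : Trivialization F (TotalSpace.proj : TotalSpace F V → M)}
    [MemTrivializationAtlas e] (hx : x ∈ e.baseSet) :
    Function.Injective (e.continuousLinearMapAt ℝ x) := by
  intro v w hvw
  have h1 := congrArg (e.symmL ℝ x) hvw
  rwa [Trivialization.symmL_continuousLinearMapAt _ hx,
    Trivialization.symmL_continuousLinearMapAt _ hx] at h1

/-- The dimension of `NormalModel E F` is a truncated subtraction; this inequality gives `E ×
NormalModel E F` the dimension of `F`. -/
theorem finrank_le (h : P.IsInjective) (x₀ : M) : Module.finrank ℝ E ≤ Module.finrank ℝ F := by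
  refine LinearMap.finrank_le_finrank_of_injective (f :=
    ((trivializationAt F V x₀).continuousLinearMapAt ℝ x₀ ∘L P.φ x₀ ∘L
      (tangentTriv E I M x₀).symmL ℝ x₀).toLinearMap) ?_
  have h1 : Function.Injective ((tangentTriv E I M x₀).symmL ℝ x₀) :=
    Function.LeftInverse.injective fun v ↦
      (tangentTriv E I M x₀).continuousLinearMapAt_symmL (mem_baseSet_trivializationAt E _ x₀) v
  exact (clmAt_injective (mem_baseSet_trivializationAt F V x₀)).comp ((h x₀ trivial).comp h1)

theorem normalFrame_bijective (hx : x ∈ P.normalBaseSet h x₀) :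
    Function.Bijective (P.normalFrame h x₀ x) := by
  refine ⟨P.normalFrame_injective h hx, fun v ↦ ?_⟩
  let e := trivializationAt F V x₀
  have hi : Function.Injective (e.continuousLinearMapAt ℝ x ∘L P.normalFrame h x₀ x).toLinearMap :=
    (clmAt_injective hx.1.1).comp (P.normalFrame_injective h hx)
  have hfin : Module.finrank ℝ (E × NormalModel E F) = Module.finrank ℝ F := by
    rw [Module.finrank_prod, finrank_euclideanSpace_fin]
    have := P.finrank_le h x₀
    omega
  obtain ⟨w, hw⟩ := (LinearMap.injective_iff_surjective_of_finrank_eq_finrank hfin).1 hi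
    (e.continuousLinearMapAt ℝ x v)
  exact ⟨w, clmAt_injective hx.1.1 hw⟩

theorem isSmoothFrame_normalFrame :
    IsSmoothFrame I (trivializationAt F V x₀) (P.normalFrame h x₀) (P.normalBaseSet h x₀) where
  isOpen := P.isOpen_normalBaseSet h x₀
  subset := P.normalBaseSet_subset_baseSet h
  smooth := by
    rintro ⟨v, k⟩ x hx
    refine ContMDiffAt.contMDiffWithinAt ?_
    simp only [normalFrame_apply]
    refine ContMDiffAt.add_section ?_ ?_
    · exact ((P.φ_smooth.contMDiffAt Filter.univ_mem).clm_bundle_apply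
        ((contMDiffOn_symmL_apply (tangentTriv E I M x₀) v).contMDiffAt
          ((tangentTriv E I M x₀).open_baseSet.mem_nhds hx.1.2)))
    · rw [contMDiffAt_section_iff_clmAt (trivializationAt F V x₀) hx.1.1]
      have h1 := (P.contMDiffOn_adapted h x₀).contMDiffAt ((P.isOpen_dom x₀).mem_nhds hx.1)
      have h2 : ContMDiffAt I 𝓘(ℝ, NormalModel E F × (E →L[ℝ] ℝ) →L[ℝ] F) ∞
          (fun y ↦ (P.adapted h x₀ y).inverse) x :=
        (hx.2.contDiffAt_map_inverse (n := ∞)).contMDiffAt.comp x h1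
      refine (h2.clm_apply (contMDiffAt_const (c := ((k, 0) : NormalModel E F ×
        (E →L[ℝ] ℝ))))).congr_of_eventuallyEq ?_
      filter_upwards [(P.isOpen_normalBaseSet h x₀).mem_nhds hx] with y hy
      exact (trivializationAt F V x₀).continuousLinearMapAt_symmL hy.1.1 _
  bijective x hx := P.normalFrame_bijective h hx

variable (x₀) in
/-- The metric in the normal frame. -/
def frameMetric (x : M) : (E × NormalModel E F) →L[ℝ] (E × NormalModel E F) →L[ℝ] ℝ :=
  (ContinuousLinearMap.precomp ℝ (P.normalFrame h x₀ x)) ∘L (P.g x ∘L P.normalFrame h x₀ x)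

theorem frameMetric_apply (v w : E × NormalModel E F) :
    P.frameMetric h x₀ x v w = P.g x (P.normalFrame h x₀ x v) (P.normalFrame h x₀ x w) := rfl

theorem contMDiffAt_g_apply (hx : x ∈ P.normalBaseSet h x₀) (v w : E × NormalModel E F) :
    ContMDiffAt I 𝓘(ℝ) ∞
      (fun y ↦ P.g y (P.normalFrame h x₀ y v) (P.normalFrame h x₀ y w)) x := by
  have hB := P.isSmoothFrame_normalFrame h (x₀ := x₀)
  have h4 : ContMDiffAt I (I.prod 𝓘(ℝ)) ∞ (fun y ↦ TotalSpace.mk' ℝ (E := Bundle.Trivial M ℝ) y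
      (P.g y (P.normalFrame h x₀ y v) (P.normalFrame h x₀ y w))) x :=
    ContMDiffAt.clm_bundle_apply₂ (F₁ := F) (F₂ := F) (F₃ := ℝ) (E₁ := V) (E₂ := V)
      (E₃ := Bundle.Trivial M ℝ) (b := fun x ↦ x) (P.g_smooth.contMDiffAt Filter.univ_mem)
      ((hB.smooth v).contMDiffAt (hB.isOpen.mem_nhds hx))
      ((hB.smooth w).contMDiffAt (hB.isOpen.mem_nhds hx))
  rw [contMDiffAt_totalSpace] at h4
  exact h4.2

theorem contMDiffAt_frameMetric (hx : x ∈ P.normalBaseSet h x₀) :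
    ContMDiffAt I 𝓘(ℝ, (E × NormalModel E F) →L[ℝ] (E × NormalModel E F) →L[ℝ] ℝ) ∞
      (P.frameMetric h x₀) x :=
  contMDiffAt_of_apply fun v ↦ contMDiffAt_of_apply fun w ↦ P.contMDiffAt_g_apply h hx v w

variable (x₀) in
/-- The coordinates in the normal frame. -/
abbrev normalCoord (x : M) : V x →L[ℝ] E × NormalModel E F :=
  frameCoord (trivializationAt F V x₀) (P.normalFrame h x₀) x

variable (x₀) in
/-- The connection form in the normal frame. -/
abbrev normalForm (x : M) : (E × NormalModel E F) →L[ℝ] E →L[ℝ] (E × NormalModel E F) :=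
  frameForm x₀ (trivializationAt F V x₀) (P.normalFrame h x₀) P.nabla x

/-- A frame section has constant coordinates, so only the connection form contributes to its
derivative. -/
theorem nabla_normalFrame (hx : x ∈ P.normalBaseSet h x₀) (w : E × NormalModel E F)
    (ξ : TangentSpace I x) :
    P.nabla (fun y ↦ P.normalFrame h x₀ y w) x ξ = P.normalFrame h x₀ x
      (P.normalForm h x₀ x w ((tangentTriv E I M x₀).continuousLinearMapAt ℝ x ξ)) := by
  have hB := P.isSmoothFrame_normalFrame h (x₀ := x₀)
  apply (hB.frameCoord_bijective hx).1
  have h1 : (fun y ↦ P.normalCoord h x₀ y (P.normalFrame h x₀ y w)) =ᶠ[𝓝 x] fun _ ↦ w := by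
    filter_upwards [hB.isOpen.mem_nhds hx] with y hy using hB.frameCoord_apply hy w
  have h2 : mvfderiv I (fun y ↦ P.normalCoord h x₀ y (P.normalFrame h x₀ y w)) x ξ = 0 := by
    change mfderiv I 𝓘(ℝ, E × NormalModel E F) _ x ξ = _
    rw [h1.mfderiv_eq, mfderiv_const]
    rfl
  rw [hB.frameCoord_cov hx (P.normalBaseSet_subset_source h)
    (P.nabla_isCovariantDerivative.mono (subset_univ _)) _
    (((hB.smooth w).contMDiffAt (hB.isOpen.mem_nhds hx)).mdifferentiableAt (by simp)), h2, zero_add,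
    hB.frameCoord_apply hx, hB.frameCoord_apply hx]

/-- Integrability enters here: `d^∇φ = 0` is applied to two coordinate vector fields, which commute
and which `φ` sends to the frame sections with coordinates `(w, 0)` and `(v, 0)`. -/
theorem normalForm_symm (hP : P.IsIntegrable) (hx : x ∈ P.normalBaseSet h x₀) (v w : E) :
    P.normalForm h x₀ x (v, 0) w = P.normalForm h x₀ x (w, 0) v := by
  have hx' := P.normalBaseSet_subset_source h hx
  let t := tangentTriv E I M x₀
  have hd : ∀ v, MDifferentiableAt I (I.prod 𝓘(ℝ, E)) (fun y ↦ TotalSpace.mk' E y (t.symmL ℝ y v))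
      x := fun v ↦
    ((contMDiffOn_symmL_apply t v).contMDiffAt (t.open_baseSet.mem_nhds hx')).mdifferentiableAt
      (by simp)
  have h1 : ∀ v, ∀ ξ : TangentSpace I x,
      mvfderiv I (fun y ↦ t.continuousLinearMapAt ℝ y (t.symmL ℝ y v)) x ξ = 0 := by
    intro v ξ
    have h1 : (fun y ↦ t.continuousLinearMapAt ℝ y (t.symmL ℝ y v)) =ᶠ[𝓝 x] fun _ ↦ v := by
      filter_upwards [t.open_baseSet.mem_nhds hx'] with y hy
      exact t.continuousLinearMapAt_symmL hy v
    change mfderiv I 𝓘(ℝ, E) _ x ξ = _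
    rw [h1.mfderiv_eq, mfderiv_const]
    rfl
  have h2 : VectorField.mlieBracket I (fun y ↦ t.symmL ℝ y w) (fun y ↦ t.symmL ℝ y v) x = 0 := by
    apply tangentTriv_injective hx'
    rw [mlieBracket_eq_chart hx' _ _ (hd w) (hd v), map_zero, h1, h1, sub_zero]
  have h3 := hP x trivial (fun y ↦ t.symmL ℝ y w) (fun y ↦ t.symmL ℝ y v) (hd w) (hd v)
  have h4 : ∀ v, (fun y ↦ P.φ y (t.symmL ℝ y v)) = fun y ↦ P.normalFrame h x₀ y (v, 0) := fun v ↦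
    funext fun y ↦ (P.normalFrame_apply_left h v).symm
  rw [dNablaφ, h2, map_zero, sub_zero, h4, h4, P.nabla_normalFrame h hx, P.nabla_normalFrame h hx,
    t.continuousLinearMapAt_symmL hx', t.continuousLinearMapAt_symmL hx', sub_eq_zero] at h3
  exact P.normalFrame_injective h hx h3

variable (x₀) in
/-- The symmetric extension of the connection form to a bilinear map on `E × N`. -/
def normalChristoffel (x : M) :
    (E × NormalModel E F) →L[ℝ] (E × NormalModel E F) →L[ℝ] (E × NormalModel E F) :=
  -- The values for horizontal `a` are forced by the connection and those for vertical `a`,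
  -- horizontal `b` by symmetry. The vertical-vertical block is unconstrained and is zero here.
  (P.normalForm h x₀ x).flip ∘L ContinuousLinearMap.fst ℝ E (NormalModel E F) +
    (ContinuousLinearMap.precomp (E × NormalModel E F)
      (ContinuousLinearMap.fst ℝ E (NormalModel E F))) ∘L
    (P.normalForm h x₀ x ∘L ContinuousLinearMap.inr ℝ E (NormalModel E F)) ∘L
    ContinuousLinearMap.snd ℝ E (NormalModel E F)

theorem normalChristoffel_apply (a b : E × NormalModel E F) :
    P.normalChristoffel h x₀ x a b =
      P.normalForm h x₀ x b a.1 + P.normalForm h x₀ x (0, a.2) b.1 := rfl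

/-- The mixed blocks are symmetric by definition and the vertical one is zero; the horizontal block
is `normalForm_symm`. -/
theorem normalChristoffel_symm (hP : P.IsIntegrable) (hx : x ∈ P.normalBaseSet h x₀)
    (a b : E × NormalModel E F) :
    P.normalChristoffel h x₀ x a b = P.normalChristoffel h x₀ x b a := by
  have h1 : ∀ a : E × NormalModel E F, a = (a.1, 0) + (0, a.2) := fun a ↦ by simp
  rw [normalChristoffel_apply, normalChristoffel_apply]
  conv_lhs => rw [h1 b]
  conv_rhs => rw [h1 a]
  simp only [map_add, add_apply, Prod.fst_add, add_zero,
    P.normalForm_symm h hP hx b.1 a.1]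
  abel

theorem contMDiffAt_normalChristoffel (hx : x ∈ P.normalBaseSet h x₀) :
    ContMDiffAt I 𝓘(ℝ, (E × NormalModel E F) →L[ℝ] (E × NormalModel E F) →L[ℝ]
      (E × NormalModel E F)) ∞ (P.normalChristoffel h x₀) x := by
  have h1 := (P.isSmoothFrame_normalFrame h (x₀ := x₀)).contMDiffAt_frameForm (cov := P.nabla) hx
    (P.normalBaseSet_subset_source h) (P.nabla_smooth x trivial)
  refine contMDiffAt_of_apply fun v ↦ contMDiffAt_of_apply fun w ↦ ?_
  simp only [normalChristoffel_apply]
  exact ((h1.clm_apply contMDiffAt_const).clm_apply contMDiffAt_const).add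
    ((h1.clm_apply contMDiffAt_const).clm_apply contMDiffAt_const)

variable (x₀) in
/-- The open subset of `E` corresponding to the domain of the normal frame. -/
def normalRegion : Set E := (extChartAt I x₀).target ∩ (extChartAt I x₀).symm ⁻¹'
  P.normalBaseSet h x₀

theorem isOpen_normalRegion : IsOpen (P.normalRegion h x₀) :=
  (continuousOn_extChartAt_symm x₀).isOpen_inter_preimage (isOpen_extChartAt_target x₀)
    (P.isOpen_normalBaseSet h x₀)

/-- The metric and the symmetric connection form along the zero section extend to a Riemannian
metric and its Christoffel symbols. -/
theorem exists_chart_metric (hP : P.IsIntegrable) :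
    ∃ (G : E × NormalModel E F → (E × NormalModel E F) →L[ℝ] (E × NormalModel E F) →L[ℝ] ℝ)
      (Γ : E × NormalModel E F → (E × NormalModel E F) →L[ℝ] (E × NormalModel E F) →L[ℝ]
        (E × NormalModel E F)),
      ContDiffOn ℝ ∞ G (P.normalRegion h x₀ ×ˢ univ) ∧
      ContDiffOn ℝ ∞ Γ (P.normalRegion h x₀ ×ˢ univ) ∧
      (∀ p ∈ P.normalRegion h x₀ ×ˢ (univ : Set (NormalModel E F)), ∀ b c, G p b c = G p c b) ∧
      (∀ p ∈ P.normalRegion h x₀ ×ˢ (univ : Set (NormalModel E F)), ∀ b, b ≠ 0 → 0 < G p b b) ∧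
      (∀ p ∈ P.normalRegion h x₀ ×ˢ (univ : Set (NormalModel E F)), ∀ a b, Γ p a b = Γ p b a) ∧
      (∀ p ∈ P.normalRegion h x₀ ×ˢ (univ : Set (NormalModel E F)), ∀ a b c,
        fderiv ℝ G p a b c = G p (Γ p a b) c + G p b (Γ p a c)) ∧
      ∀ x ∈ P.normalBaseSet h x₀, G (extChartAt I x₀ x, 0) = P.frameMetric h x₀ x ∧
        Γ (extChartAt I x₀ x, 0) = P.normalChristoffel h x₀ x := by
  have key : ∀ u ∈ P.normalRegion h x₀, (extChartAt I x₀).symm u ∈ (chartAt H x₀).source ∧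
      extChartAt I x₀ ((extChartAt I x₀).symm u) = u :=
    fun u hu ↦ ⟨P.normalBaseSet_subset_source h hu.2, (extChartAt I x₀).right_inv hu.1⟩
  have hG : ContDiffOn ℝ ∞ (P.frameMetric h x₀ ∘ (extChartAt I x₀).symm)
      (P.normalRegion h x₀) := fun u hu ↦ by
    have := contDiffAt_chart (key u hu).1 (P.contMDiffAt_frameMetric h hu.2)
    rw [(key u hu).2] at this
    exact this.contDiffWithinAt
  have hΓ : ContDiffOn ℝ ∞ (P.normalChristoffel h x₀ ∘ (extChartAt I x₀).symm)
      (P.normalRegion h x₀) := fun u hu ↦ by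
    have := contDiffAt_chart (key u hu).1 (P.contMDiffAt_normalChristoffel h hu.2)
    rw [(key u hu).2] at this
    exact this.contDiffWithinAt
  obtain ⟨G, Γ, h1, h2, h3, h4, h5, h6, h7⟩ := exists_metric_extension (P.isOpen_normalRegion h)
    hG hΓ (fun u hu b c ↦ P.g_symm _ trivial _ _)
    (fun u hu b hb ↦ P.g_pos _ trivial _
      ((map_ne_zero_iff _ (P.normalFrame_injective h hu.2)).2 hb))
    (fun u hu ↦ P.normalChristoffel_symm h hP hu.2) (by
      intro u hu e b c
      have hd : DifferentiableAt ℝ (P.frameMetric h x₀ ∘ (extChartAt I x₀).symm) u :=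
        (hG.contDiffAt ((P.isOpen_normalRegion h).mem_nhds hu)).differentiableAt (by simp)
      have hB := P.isSmoothFrame_normalFrame h (x₀ := x₀)
      have hBd : ∀ w, MDifferentiableAt I (I.prod 𝓘(ℝ, F))
          (fun y ↦ TotalSpace.mk' F y (P.normalFrame h x₀ y w)) ((extChartAt I x₀).symm u) :=
        fun w ↦ ((hB.smooth w).contMDiffAt (hB.isOpen.mem_nhds hu.2)).mdifferentiableAt (by simp)
      -- Compatibility of `∇` with `g`, for two frame sections and a coordinate direction, is the
      -- horizontal compatibility required by the extension.
      have h1 := P.nabla_metric ((extChartAt I x₀).symm u) trivial _ _ (hBd b) (hBd c)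
        ((tangentTriv E I M x₀).symmL ℝ ((extChartAt I x₀).symm u) e)
      rw [P.nabla_normalFrame h hu.2, P.nabla_normalFrame h hu.2,
        mvfderiv_eq_chart (key u hu).1 ((P.contMDiffAt_g_apply h hu.2 b c).mdifferentiableAt
          (by simp)), (tangentTriv E I M x₀).continuousLinearMapAt_symmL (key u hu).1,
        (key u hu).2] at h1
      refine (fderiv_apply₂ hd e b c).trans (h1.trans ?_)
      simp only [Function.comp_apply, frameMetric_apply, normalChristoffel_apply]
      -- In a horizontal direction `(e, 0)` the symmetrizing term of `normalChristoffel` is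
      -- evaluated at `(0, 0)` and disappears.
      have h0 : ((0, 0) : E × NormalModel E F) = 0 := rfl
      simp [h0])
  refine ⟨G, Γ, h1, h2, h3, h4, h5, h6, fun x hx ↦ ?_⟩
  have hx' : x ∈ (extChartAt I x₀).source := by
    rw [extChartAt_source]
    exact P.normalBaseSet_subset_source h hx
  have h8 := h7 (extChartAt I x₀ x) ⟨(extChartAt I x₀).map_source hx',
    by rwa [mem_preimage, (extChartAt I x₀).left_inv hx']⟩
  rwa [Function.comp_apply, Function.comp_apply, (extChartAt I x₀).left_inv hx'] at h8

end RiemannianPuzzle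

end NormalFrame

/-! ### The zero section of a vector bundle in charts, and as a smooth embedding. -/

section ZeroSection

set_option maxSynthPendingDepth 3
set_option linter.unusedSectionVars false

variable {E : Type*} [NormedAddCommGroup E] [NormedSpace ℝ E]
  {H : Type*} [TopologicalSpace H] {I : ModelWithCorners ℝ E H}
  {M : Type*} [TopologicalSpace M] [ChartedSpace H M] [IsManifold I ∞ M]
  {K : Type*} [NormedAddCommGroup K] [NormedSpace ℝ K]
  {N : M → Type*} [TopologicalSpace (TotalSpace K N)]
  [∀ x, AddCommGroup (N x)] [∀ x, Module ℝ (N x)] [∀ x, TopologicalSpace (N x)]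
  [FiberBundle K N] [VectorBundle ℝ K N] [ContMDiffVectorBundle ∞ K N I]

theorem extChartAt_zeroSection {x₀ x : M} (hx : x ∈ (trivializationAt K N x₀).baseSet) :
    extChartAt (I.prod 𝓘(ℝ, K)) (zeroSection K N x₀) (zeroSection K N x) =
      (extChartAt I x₀ x, 0) := by
  rw [FiberBundle.extChartAt]
  have h1 := (trivializationAt K N x₀).zeroSection ℝ hx
  change ((extChartAt I x₀).prod (PartialEquiv.refl K))
    (trivializationAt K N x₀ (zeroSection K N x)) = _
  rw [h1]
  rfl

variable (I K N) in
theorem isSmoothEmbedding_zeroSection :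
    Manifold.IsSmoothEmbedding I (I.prod 𝓘(ℝ, K)) ∞ (zeroSection K N) where
  isImmersion := by
    refine Manifold.IsImmersionOfComplement.isImmersion (F := K) fun x ↦ ?_
    have ho := (trivializationAt K N x).open_baseSet
    refine Manifold.IsImmersionAtOfComplement.mk_of_continuousAt
      (contMDiff_zeroSection ℝ N (n := ∞) (IB := I)).continuous.continuousAt
      (ContinuousLinearEquiv.refl ℝ (E × K))
      -- The chart is restricted to the base set of the trivialization so that the zero section
      -- reads `u ↦ (u, 0)` on its whole target.
      ((chartAt H x).restr (trivializationAt K N x).baseSet)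
      (chartAt (ModelProd H K) (zeroSection K N x)) ?_ (mem_chart_source _ _)
      (restr_mem_maximalAtlas _ (IsManifold.chart_mem_maximalAtlas x) ho)
      (IsManifold.chart_mem_maximalAtlas _) ?_
    · rw [OpenPartialHomeomorph.restr_source, ho.interior_eq]
      exact ⟨mem_chart_source H x, mem_baseSet_trivializationAt K N x⟩
    · intro u hu
      have hs := (((chartAt H x).restr (trivializationAt K N x).baseSet).extend I).map_target hu
      have hr := (((chartAt H x).restr (trivializationAt K N x).baseSet).extend I).right_inv hu
      rw [OpenPartialHomeomorph.extend_source, OpenPartialHomeomorph.restr_source,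
        ho.interior_eq] at hs
      refine (extChartAt_zeroSection (I := I) hs.2).trans ?_
      exact congrArg (fun v ↦ ((v, 0) : E × K)) hr
  -- The bundle projection is a continuous left inverse.
  isEmbedding := Function.LeftInverse.isEmbedding (f := TotalSpace.proj) (fun _ ↦ rfl)
    (FiberBundle.continuous_proj K N) (contMDiff_zeroSection ℝ N (n := ∞) (IB := I)).continuous

end ZeroSection

/-! ### Tangent maps of maps that are linear in charts. -/

section Tangent

set_option maxSynthPendingDepth 3
set_option linter.unusedSectionVars false

variable {E : Type*} [NormedAddCommGroup E] [NormedSpace ℝ E]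
  {H : Type*} [TopologicalSpace H] {I : ModelWithCorners ℝ E H} [I.Boundaryless]
  {M : Type*} [TopologicalSpace M] [ChartedSpace H M] [IsManifold I ∞ M]
  {E' : Type*} [NormedAddCommGroup E'] [NormedSpace ℝ E']
  {H' : Type*} [TopologicalSpace H'] {I' : ModelWithCorners ℝ E' H'} [I'.Boundaryless]
  {M' : Type*} [TopologicalSpace M'] [ChartedSpace H' M'] [IsManifold I' ∞ M']

/-- The coordinates of the derivative of a map which is `A ∘ θ` in charts, `A` being linear. -/
theorem continuousLinearMapAt_mfderiv {u : M → M'} {x₀ x : M} {p₀ : M'}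
    (hu : MDifferentiableAt I I' u x) (hx : x ∈ (chartAt H x₀).source)
    (hp : u x ∈ (chartAt H' p₀).source) (A : E →L[ℝ] E')
    (hA : ∀ᶠ y in 𝓝 x, extChartAt I' p₀ (u y) = A (extChartAt I x₀ y)) (ξ : TangentSpace I x) :
    (tangentTriv E' I' M' p₀).continuousLinearMapAt ℝ (u x) (mfderiv I I' u x ξ) =
      A ((tangentTriv E I M x₀).continuousLinearMapAt ℝ x ξ) := by
  have h1 : MDifferentiableAt I' 𝓘(ℝ, E') (extChartAt I' p₀) (u x) :=
    mdifferentiableAt_extChartAt hp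
  have h2 : MDifferentiableAt I 𝓘(ℝ, E) (extChartAt I x₀) x := mdifferentiableAt_extChartAt hx
  have h3 := h1.hasMFDerivAt.comp x hu.hasMFDerivAt
  have h4 := (A.hasMFDerivAt (x := extChartAt I x₀ x)).comp x h2.hasMFDerivAt
  have h5 := hasMFDerivAt_unique (h3.congr_of_eventuallyEq (hA.mono fun y hy ↦ hy.symm)) h4
  rw [TangentBundle.continuousLinearMapAt_trivializationAt hp,
    TangentBundle.continuousLinearMapAt_trivializationAt hx]
  exact DFunLike.congr_fun h5 ξ

end Tangent

/-! ### A criterion for a puzzle to be the pull-back of a chart puzzle. -/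

section ChartPullback

set_option maxSynthPendingDepth 3
set_option linter.unusedSectionVars false

variable {E : Type*} [NormedAddCommGroup E] [NormedSpace ℝ E] [FiniteDimensional ℝ E]
  {H : Type*} [TopologicalSpace H] {I : ModelWithCorners ℝ E H} [I.Boundaryless]
  {M : Type*} [TopologicalSpace M] [ChartedSpace H M] [IsManifold I ∞ M]
  {F : Type*} [NormedAddCommGroup F] [NormedSpace ℝ F] [FiniteDimensional ℝ F]
  {V : M → Type*} [TopologicalSpace (TotalSpace F V)]
  [∀ x, AddCommGroup (V x)] [∀ x, Module ℝ (V x)] [∀ x, TopologicalSpace (V x)]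
  [∀ x, IsTopologicalAddGroup (V x)] [∀ x, ContinuousSMul ℝ (V x)]
  [FiberBundle F V] [VectorBundle ℝ F V] [ContMDiffVectorBundle ∞ F V I]
  {W : Type*} [NormedAddCommGroup W] [NormedSpace ℝ W] [FiniteDimensional ℝ W]
  {H' : Type*} [TopologicalSpace H'] {I' : ModelWithCorners ℝ W H'} [I'.Boundaryless]
  {M' : Type*} [TopologicalSpace M'] [ChartedSpace H' M'] [IsManifold I' ∞ M']

variable (I') in
/-- The bundle map which sends the frame `B` to the coordinate frame of the chart at `p₀`. -/
def frameToChart (e : Trivialization F (TotalSpace.proj : TotalSpace F V → M))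
    [MemTrivializationAtlas e] (B : Π x : M, W →L[ℝ] V x) (u : M → M') (p₀ : M') (x : M) :
    V x →L[ℝ] TangentSpace I' (u x) :=
  (tangentTriv W I' M' p₀).symmL ℝ (u x) ∘L frameCoord e B x

variable {e : Trivialization F (TotalSpace.proj : TotalSpace F V → M)} [MemTrivializationAtlas e]
  {B : Π x : M, W →L[ℝ] V x} {O U : Set M} {u : M → M'} {p₀ : M'} {x₀ : M}

theorem continuousLinearMapAt_frameToChart {x : M} (hx : u x ∈ (chartAt H' p₀).source) (v : V x) :
    (tangentTriv W I' M' p₀).continuousLinearMapAt ℝ (u x) (frameToChart I' e B u p₀ x v) =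
      frameCoord e B x v :=
  (tangentTriv W I' M' p₀).continuousLinearMapAt_symmL hx _

theorem contMDiffOn_frameToChart (hB : IsSmoothFrame I e B O) (hu : ContMDiffOn I I' ∞ u O)
    (hmaps : MapsTo u O (chartAt H' p₀).source) :
    ContMDiffOn (I.prod 𝓘(ℝ, F)) (I'.prod 𝓘(ℝ, W)) ∞
      (fun p : TotalSpace F V ↦ TotalSpace.mk' W (u p.1) (frameToChart I' e B u p₀ p.1 p.2))
      (TotalSpace.proj ⁻¹' O) := by
  intro p hp
  have hO : TotalSpace.proj ⁻¹' O ∈ 𝓝 p :=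
    (hB.isOpen.preimage (FiberBundle.continuous_proj F V)).mem_nhds hp
  have hpr : ContMDiffAt (I.prod 𝓘(ℝ, F)) I ∞ (TotalSpace.proj : TotalSpace F V → M) p :=
    contMDiff_proj V p
  refine ContMDiffAt.contMDiffWithinAt ?_
  have hsrc : TotalSpace.mk' W (u p.1) (frameToChart I' e B u p₀ p.1 p.2) ∈
      (tangentTriv W I' M' p₀).source := (tangentTriv W I' M' p₀).mem_source.2 (hmaps hp)
  refine ((tangentTriv W I' M' p₀).contMDiffAt_iff (f := fun p : TotalSpace F V ↦
    TotalSpace.mk' W (u p.1) (frameToChart I' e B u p₀ p.1 p.2)) hsrc).2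
    ⟨(hu.contMDiffAt (hB.isOpen.mem_nhds hp)).comp p hpr, ?_⟩
  have h1 := (hB.contMDiffAt_inverse hp).comp p hpr
  have h2 : ContMDiffAt (I.prod 𝓘(ℝ, F)) 𝓘(ℝ, F) ∞ (fun q ↦ (e q).2) p :=
    ((e.contMDiffAt_iff (e.mem_source.2 (show p.1 ∈ _ from hB.subset hp))).1 contMDiffAt_id).2
  refine (h1.clm_apply h2).congr_of_eventuallyEq ?_
  filter_upwards [hO] with q hq
  have h3 := continuousLinearMapAt_frameToChart (I' := I') (e := e) (B := B) (hmaps hq) q.2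
  rw [Trivialization.continuousLinearMapAt_apply,
    Trivialization.coe_linearMapAt_of_mem _ (hmaps hq)] at h3
  refine h3.trans ?_
  rw [frameCoord, ContinuousLinearMap.comp_apply, Trivialization.continuousLinearMapAt_apply,
    Trivialization.coe_linearMapAt_of_mem _ (hB.subset hq)]
  rfl

/-- A puzzle is a pull-back of the puzzle of a chart if its data, read in a frame, agree with the
coefficients of the latter. -/
theorem isPullbackVia_chartPuzzle (P : RiemannianPuzzle I F V U)
    {G : W → W →L[ℝ] W →L[ℝ] ℝ} {Γ : W → W →L[ℝ] W →L[ℝ] W} {hG hΓ hs hpos hcompat}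
    (hB : IsSmoothFrame I e B O) (hOU : O ⊆ U) (hO : O ⊆ (chartAt H x₀).source)
    (hu : ContMDiffOn I I' ∞ u O) (hmaps : MapsTo u O (chartAt H' p₀).source) (A : E →L[ℝ] W)
    (hA : ∀ x ∈ O, extChartAt I' p₀ (u x) = A (extChartAt I x₀ x))
    (hGB : ∀ x ∈ O, ∀ b c, G (extChartAt I' p₀ (u x)) b c = P.g x (B x b) (B x c))
    (hΓB : ∀ x ∈ O, ∀ a b, Γ (extChartAt I' p₀ (u x)) (A a) b = frameForm x₀ e B P.nabla x b a)
    (hφB : ∀ x ∈ O, ∀ a, P.φ x ((tangentTriv E I M x₀).symmL ℝ x a) = B x (A a)) :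
    P.IsPullbackVia (chartPuzzle (I := I') p₀ G Γ hG hΓ hs hpos hcompat) O u
      (frameToChart I' e B u p₀) := by
  have hd : ∀ x ∈ O, ∀ ξ : TangentSpace I x,
      (tangentTriv W I' M' p₀).continuousLinearMapAt ℝ (u x) (mfderiv I I' u x ξ) =
        A ((tangentTriv E I M x₀).continuousLinearMapAt ℝ x ξ) := fun x hx ξ ↦
    continuousLinearMapAt_mfderiv ((hu.contMDiffAt (hB.isOpen.mem_nhds hx)).mdifferentiableAt
      (by simp)) (hO hx) (hmaps hx) A (Filter.eventually_of_mem (hB.isOpen.mem_nhds hx) hA) ξ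
  refine ⟨hB.isOpen, hOU, hmaps, hu, fun x hx ↦ ?_, contMDiffOn_frameToChart hB hu hmaps,
    fun x hx v w ↦ ?_, fun x hx ξ ↦ ?_, fun x hx σ τ hσ hτ hστ ξ ↦ ?_⟩
  · have h1 : Function.Bijective ((tangentTriv W I' M' p₀).symmL ℝ (u x)) :=
      Function.bijective_iff_has_inverse.2 ⟨(tangentTriv W I' M' p₀).continuousLinearMapAt ℝ (u x),
        (tangentTriv W I' M' p₀).continuousLinearMapAt_symmL (hmaps hx),
        (tangentTriv W I' M' p₀).symmL_continuousLinearMapAt (hmaps hx)⟩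
    exact h1.comp (hB.frameCoord_bijective hx)
  · change _ = chartMetric p₀ G (u x) _ _
    rw [chartMetric_apply, continuousLinearMapAt_frameToChart (hmaps hx),
      continuousLinearMapAt_frameToChart (hmaps hx), hGB x hx, hB.apply_frameCoord hx,
      hB.apply_frameCoord hx]
  · apply tangentTriv_injective (hmaps hx)
    refine (continuousLinearMapAt_frameToChart (hmaps hx) _).trans (Eq.trans ?_ (hd x hx ξ).symm)
    -- Both `Φ(φ ξ)` and `du ξ` have coordinates `A` applied to those of `ξ`: the former by `hφB`,
    -- the latter because `u` reads as `A` in the charts.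
    rw [← (tangentTriv E I M x₀).symmL_continuousLinearMapAt (R := ℝ) (hO hx) ξ, hφB x hx,
      hB.frameCoord_apply hx, (tangentTriv E I M x₀).symmL_continuousLinearMapAt (hO hx)]
  · apply tangentTriv_injective (hmaps hx)
    refine (continuousLinearMapAt_frameToChart (hmaps hx) _).trans ?_
    change _ = (tangentTriv W I' M' p₀).continuousLinearMapAt ℝ (u x) (chartNabla p₀ Γ τ (u x) _)
    -- The relation `Φ σ = τ ∘ u` says that the frame coordinates of `σ` are the chart coordinates
    -- of `τ` along `u`. The chain rule then matches the derivative terms, and `hΓB` the terms of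
    -- order zero.
    have hs : (fun y ↦ frameCoord e B y (σ y)) =ᶠ[𝓝 x]
        (fun q ↦ (tangentTriv W I' M' p₀).continuousLinearMapAt ℝ q (τ q)) ∘ u := by
      filter_upwards [hστ, hB.isOpen.mem_nhds hx] with y hy hyO
      rw [← continuousLinearMapAt_frameToChart (I' := I') (hmaps hyO), hy]
      rfl
    have hτ' := (mdifferentiableAt_section_iff_clmAt (tangentTriv W I' M' p₀) (hmaps hx) τ).1 hτ
    have hu' := (hu.contMDiffAt (hB.isOpen.mem_nhds hx)).mdifferentiableAt (n := ∞) (by simp)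
    have hder : mvfderiv I (fun y ↦ frameCoord e B y (σ y)) x ξ = mvfderiv I' (fun q ↦
        (tangentTriv W I' M' p₀).continuousLinearMapAt ℝ q (τ q)) (u x) (mfderiv I I' u x ξ) := by
      change mfderiv I 𝓘(ℝ, W) _ x ξ = _
      rw [hs.mfderiv_eq, mfderiv_comp x hτ' hu']
      rfl
    rw [chartNabla_apply (hmaps hx) τ hτ, hB.frameCoord_cov hx hO
      (P.nabla_isCovariantDerivative.mono hOU) σ hσ, hder, hd x hx ξ, hΓB x hx]
    exact congrArg (fun w ↦ _ + frameForm x₀ e B P.nabla x w _) hs.self_of_nhds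

end ChartPullback

/-! ### The puzzle on the normal bundle. -/

section NormalChart

set_option maxSynthPendingDepth 3
set_option linter.unusedSectionVars false

variable {E : Type*} [NormedAddCommGroup E] [NormedSpace ℝ E] [FiniteDimensional ℝ E]
  {H : Type*} [TopologicalSpace H] {I : ModelWithCorners ℝ E H} [I.Boundaryless]
  {M : Type*} [TopologicalSpace M] [ChartedSpace H M] [IsManifold I ∞ M]
  {F : Type*} [NormedAddCommGroup F] [NormedSpace ℝ F] [FiniteDimensional ℝ F]
  {V : M → Type*} [TopologicalSpace (TotalSpace F V)]
  [∀ x, AddCommGroup (V x)] [∀ x, Module ℝ (V x)] [∀ x, TopologicalSpace (V x)]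
  [∀ x, IsTopologicalAddGroup (V x)] [∀ x, ContinuousSMul ℝ (V x)]
  [FiberBundle F V] [VectorBundle ℝ F V] [ContMDiffVectorBundle ∞ F V I]

namespace RiemannianPuzzle

variable (P : RiemannianPuzzle I F V univ) (h : P.IsInjective) (x₀ : M)

theorem extChartAt_zeroSec_target :
    (extChartAt (I.prod 𝓘(ℝ, NormalModel E F)) (P.zeroSec h x₀)).target =
      P.normalRegion h x₀ ×ˢ univ :=
  FiberBundle.extChartAt_target (P.zeroSec h x₀)

/-- A single chart covers exactly the part of the normal bundle above `normalBaseSet`; coefficients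
in this chart therefore define the metric on all of `N_O M`. -/
theorem chartAt_zeroSec_source :
    (chartAt (ModelProd H (NormalModel E F)) (P.zeroSec h x₀)).source =
      P.above h (P.normalBaseSet h x₀) := by
  rw [FiberBundle.chartedSpace_chartAt]
  ext p
  have h1 : p ∈ (trivializationAt (NormalModel E F) (NormalFiber P h) x₀).source ↔
      p ∈ P.above h (P.normalBaseSet h x₀) :=
    (trivializationAt (NormalModel E F) (NormalFiber P h) x₀).mem_source
  rw [OpenPartialHomeomorph.trans_source]
  refine ⟨fun hp ↦ h1.1 hp.1, fun hp ↦ ⟨h1.2 hp, ?_, trivial⟩⟩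
  change (trivializationAt (NormalModel E F) (NormalFiber P h) x₀ p).1 ∈ (chartAt H x₀).source
  rw [Trivialization.coe_fst _ (h1.2 hp)]
  exact P.normalBaseSet_subset_source h hp

theorem exists_normal_puzzle (hP : P.IsIntegrable) :
    ∃ Q : RiemannianPuzzle (I.prod 𝓘(ℝ, NormalModel E F)) (E × NormalModel E F)
        (TangentSpace (I.prod 𝓘(ℝ, NormalModel E F)) : P.NormalBundle h → Type _)
        (chartAt (ModelProd H (NormalModel E F)) (P.zeroSec h x₀)).source,
      Q.IsLeviCivita ∧ Q.HasIdentityForm ∧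
      P.ZeroSecIsIsometricEmbedding h (P.normalBaseSet h x₀) Q.g ∧
      P.IsPullback Q (P.normalBaseSet h x₀) (P.zeroSec h) := by
  obtain ⟨G, Γ, hG, hΓ, hs, hpos, hΓs, hcompat, hGΓ⟩ := P.exists_chart_metric h hP (x₀ := x₀)
  rw [← P.extChartAt_zeroSec_target h x₀] at hG hΓ hs hpos hΓs hcompat
  have hB := P.isSmoothFrame_normalFrame h (x₀ := x₀)
  have hθ : ∀ x ∈ P.normalBaseSet h x₀, extChartAt (I.prod 𝓘(ℝ, NormalModel E F))
      (P.zeroSec h x₀) (P.zeroSec h x) = (extChartAt I x₀ x, 0) := fun x hx ↦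
    extChartAt_zeroSection (I := I) hx
  have hpull : P.IsPullbackVia (chartPuzzle (I := I.prod 𝓘(ℝ, NormalModel E F)) (P.zeroSec h x₀)
      G Γ hG hΓ hs hpos hcompat) (P.normalBaseSet h x₀) (P.zeroSec h)
      (frameToChart _ (trivializationAt F V x₀) (P.normalFrame h x₀) _ (P.zeroSec h x₀)) := by
    refine isPullbackVia_chartPuzzle P hB (subset_univ _) (P.normalBaseSet_subset_source h)
      (contMDiff_zeroSection ℝ (NormalFiber P h)).contMDiffOn ?_
      -- In the charts the zero section is the inclusion `e ↦ (e, 0)`, so only the horizontal values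
      -- of `Γ` are compared with `∇`, and there `normalChristoffel` is the connection form.
      (ContinuousLinearMap.inl ℝ E (NormalModel E F)) hθ ?_ ?_ ?_
    · intro x hx
      rw [P.chartAt_zeroSec_source h x₀]
      exact hx
    · intro x hx b c
      rw [hθ x hx, (hGΓ x hx).1]
      rfl
    · intro x hx a b
      rw [hθ x hx, (hGΓ x hx).2, normalChristoffel_apply]
      have h0 : ((0, 0) : E × NormalModel E F) = 0 := rfl
      simp [h0]
    · intro x hx a
      exact (P.normalFrame_apply_left h a).symm
  refine ⟨_, isLeviCivita_chartPuzzle hΓs, fun _ _ ↦ rfl,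
    ⟨isSmoothEmbedding_zeroSection I (NormalModel E F) (NormalFiber P h), fun x hx ξ η ↦ ?_⟩,
    _, hpull⟩
  -- The isometry property is a consequence of the pull-back: `Φ` preserves the metrics and `Φ ∘ φ =
  -- dι`.
  rw [hpull.g_eq x hx, hpull.φ_eq x hx, hpull.φ_eq x hx]
  rfl

end RiemannianPuzzle

end NormalChart

end Puzzle

end

theorem mainTheorem1
    {E : Type*} [NormedAddCommGroup E] [NormedSpace ℝ E] [FiniteDimensional ℝ E]
    {H : Type*} [TopologicalSpace H] {I : ModelWithCorners ℝ E H} [I.Boundaryless]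
    {M : Type*} [TopologicalSpace M] [ChartedSpace H M] [IsManifold I ∞ M]
    {F : Type*} [NormedAddCommGroup F] [NormedSpace ℝ F] [FiniteDimensional ℝ F]
    {V : M → Type*} [TopologicalSpace (TotalSpace F V)]
    [∀ x, AddCommGroup (V x)] [∀ x, Module ℝ (V x)] [∀ x, TopologicalSpace (V x)]
    [∀ x, IsTopologicalAddGroup (V x)] [∀ x, ContinuousSMul ℝ (V x)]
    [FiberBundle F V] [VectorBundle ℝ F V] [ContMDiffVectorBundle ∞ F V I]
    (P : Puzzle.RiemannianPuzzle I F V univ) (hP : P.IsIntegrable) (hφ : P.IsInjective) (x₀ : M) :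
    ∃ O : Set M, IsOpen O ∧ x₀ ∈ O ∧
      ∃ Q : Puzzle.RiemannianPuzzle (I.prod 𝓘(ℝ, Puzzle.RiemannianPuzzle.NormalModel E F))
          (E × Puzzle.RiemannianPuzzle.NormalModel E F)
          (TangentSpace (I.prod 𝓘(ℝ, Puzzle.RiemannianPuzzle.NormalModel E F)) :
            P.NormalBundle hφ → Type _)
          (P.above hφ O),
        Q.IsLeviCivita ∧ Q.HasIdentityForm ∧
        P.ZeroSecIsIsometricEmbedding hφ O Q.g ∧
        P.IsPullback Q O (P.zeroSec hφ) := by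
  have key := P.exists_normal_puzzle hφ x₀ hP
  rw [P.chartAt_zeroSec_source hφ x₀] at key
  exact ⟨P.normalBaseSet hφ x₀, P.isOpen_normalBaseSet hφ x₀, P.mem_normalBaseSet hφ x₀, key⟩
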